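/- Let $p\ge 1$, $n\ge 2$ and $B\ge 0$. We observe a $p\times n$ matrix $X=\theta+E$, where $\theta$ is deterministic and $E=(E_1,\dots,E_n)$ is a centred, jointly Gaussian matrix with covariance matrix $\Sigma\in\mathcal C(p,n,B)$. Here $\mathcal C(p,n,B)$ is the set of covariance (symmetric positive semidefinite) matrices $\Sigma\in\mathbb R^{pn\times pn}$ such that, for every $t\in\{1,\dots,n\}$, $\mathrm{Cov}(E_t)=I_p$ and $\sum_{s\ne t}\|\mathrm{Cov}(E_s,E_t)\|_{\mathrm{op}}\le B$. Write $\mathbb E_{\theta,\Sigma}$ for the expectation under this model. Let $\Theta_0(p,n)$ be the set of $\theta\in\mathbb R^{p\times n}$ all of whose columns are equal. For $\rho>0$, let $\Theta(p,n,p,\rho)$ be the set of $\theta\in\mathbb R^{p\times n}$ for which there are $t_0\in\{1,\dots,n-1\}$ and $\mu_1,\mu_2\in\mathbb R^p$ with $\theta_t=\mu_1$ for $t\le t_0$, $\theta_t=\mu_2$ for $t>t_0$ and $\frac{t_0(n-t_0)}{n}\|\mu_1-\mu_2\|^2\ge\rho^2$. Define the minimax testing error $$\mathcal R(\rho)=\inf_{\psi}\Bigl\{\sup_{\theta\in\Theta_0(p,n),\,\Sigma\in\mathcal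 C(p,n,B)}\mathbb E_{\theta,\Sigma}\,\psi(X)+\sup_{\theta\in\Theta(p,n,p,\rho),\,\Sigma\in\mathcal C(p,n,B)}\mathbb E_{\theta,\Sigma}\bigl(1-\psi(X)\bigr)\Bigr\},$$ the infimum being over all measurable $\psi:\mathbb R^{p\times n}\to[0,1]$. Let $\rho^*_{\mathrm{Temp}}\ge 0$ be given by $$\rho_{\mathrm{Temp}}^{*2}=Bp+(1+B)\bigl\{\sqrt{p\log\log(8n)}\vee\log\log(8n)\bigr\}.$$ (i) (Lower bound.) For every $\epsilon>0$ there is $p_\epsilon\in\mathbb N$, depending only on $\epsilon$, and for every $D>0$ there is moreover $c_{\epsilon,D}>0$, depending only on $\epsilon$ and $D$, such that $\mathcal R(c\rho^*_{\mathrm{Temp}})\ge 1-\epsilon$ whenever $c\in(0,c_{\epsilon,D})$, $p\ge p_\epsilon$, $n\ge 2$ and $0\le B\le D\sqrt{n/p}$. (ii) (Matching upper bound.) For every $\epsilon\in(0,1)$ there is $C_\epsilon>0$, depending only on $\epsilon$, such that $\mathcal R(C\rho^*_{\mathrm{Temp}})\le\epsilon$ for all $C>C_\epsilon$, $p\ge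 1$, $n\ge 2$ and $B\ge 0$. Thus $\rho^*_{\mathrm{Temp}}$ is the minimax rate of testing when $B\le D\sqrt{n/p}$ and $p\ge p_\epsilon$ (in the lower bound). -/

import Mathlib

open MeasureTheory ProbabilityTheory

noncomputable section

namespace TemporalChangepoint

/-- Real `p × n` matrices, with entry `(j, t)` in row (coordinate) `j` and column (time) `t`.
Times are indexed by `Fin n`, so that `t : Fin n` stands for time `t + 1`.
The topology, the Borel σ-algebra and the (Frobenius) norm are those of `ℝ^(pn)`. -/
abbrev Mat (p n : ℕ) : Type := EuclideanSpace ℝ (Fin p × Fin n)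

/-- Mean matrices without a changepoint: all columns are equal to one `μ ∈ ℝ^p`. -/
def nullSpace (p n : ℕ) : Set (Mat p n) :=
  {θ | ∃ μ : EuclideanSpace ℝ (Fin p), ∀ j t, θ (j, t) = μ j}

/-- Mean matrices with a change at time `t₀`: the first `t₀` columns are `μ₁`, the other ones
are `μ₂`, where `μ₁ - μ₂` has at most `s` nonzero entries and
`(t₀ (n - t₀) / n) ‖μ₁ - μ₂‖² ≥ ρ²`. -/
def altSpaceAt (t₀ p n s : ℕ) (ρ : ℝ) : Set (Mat p n) :=
  {θ | ∃ μ₁ μ₂ : EuclideanSpace ℝ (Fin p),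
    (∀ j (t : Fin n), (t : ℕ) < t₀ → θ (j, t) = μ₁ j) ∧
    (∀ j (t : Fin n), t₀ ≤ (t : ℕ) → θ (j, t) = μ₂ j) ∧
    {j : Fin p | μ₁ j - μ₂ j ≠ 0}.ncard ≤ s ∧
    ρ ^ 2 ≤ (t₀ : ℝ) * ((n : ℝ) - (t₀ : ℝ)) / (n : ℝ) * ‖μ₁ - μ₂‖ ^ 2}

/-- Mean matrices with a change at some time `t₀ ∈ {1, …, n - 1}`. -/
def altSpace (p n s : ℕ) (ρ : ℝ) : Set (Mat p n) :=
  {θ | ∃ t₀ : ℕ, 1 ≤ t₀ ∧ t₀ < n ∧ θ ∈ altSpaceAt t₀ p n s ρ}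

/-- The `p × p` block `Cov(E_s, E_t)` of the covariance matrix `S` of `E = (E_1, …, E_n)`. -/
def block {p n : ℕ} (S : Matrix (Fin p × Fin n) (Fin p × Fin n) ℝ) (s t : Fin n) :
    Matrix (Fin p) (Fin p) ℝ :=
  Matrix.of fun i j => S (i, s) (j, t)

/-- The operator norm (largest singular value) of a square matrix. -/
def opNorm {p : ℕ} (A : Matrix (Fin p) (Fin p) ℝ) : ℝ :=
  ‖Matrix.toEuclideanCLM (n := Fin p) (𝕜 := ℝ) A‖

/-- The class of covariance matrices with `Cov(E_t) = I_p` for all `t` and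
`∑_{s ≠ t} ‖Cov(E_s, E_t)‖_op ≤ B` for all `t`. -/
def covClass (p n : ℕ) (B : ℝ) : Set (Matrix (Fin p × Fin n) (Fin p × Fin n) ℝ) :=
  {S | S.PosSemidef ∧ (∀ t, block S t t = 1) ∧
    ∀ t, ∑ s ∈ Finset.univ.erase t, opNorm (block S s t) ≤ B}

/-- The law of `X = θ + E`, where `E` is centred Gaussian with covariance matrix `S`. -/
def law {p n : ℕ} (θ : Mat p n) (S : Matrix (Fin p × Fin n) (Fin p × Fin n) ℝ) :
    Measure (Mat p n) :=
  multivariateGaussian θ S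

/-- Tests: measurable functions from the sample space to `[0, 1]`. -/
def tests (p n : ℕ) : Set (Mat p n → ℝ) :=
  {ψ | Measurable ψ ∧ ∀ X, 0 ≤ ψ X ∧ ψ X ≤ 1}

/-- The minimax testing error in the dense case `s = p`. All expectations lie in `[0, 1]`. -/
def minimaxError (p n : ℕ) (B ρ : ℝ) : ℝ :=
  ⨅ ψ : tests p n,
    ((⨆ x : nullSpace p n × covClass p n B,
        ∫ X, ψ.1 X ∂(law x.1.1 x.2.1)) +
      ⨆ x : altSpace p n p ρ × covClass p n B,
        ∫ X, (1 - ψ.1 X) ∂(law x.1.1 x.2.1))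

/-- `ρ_Temp*`, the square root of
`B p + (1 + B) max (√(p log log (8n))) (log log (8n))`. -/
def rhoTemp (p n : ℕ) (B : ℝ) : ℝ :=
  Real.sqrt (B * (p : ℝ) + (1 + B) *
    max (Real.sqrt ((p : ℝ) * Real.log (Real.log (8 * (n : ℝ)))))
      (Real.log (Real.log (8 * (n : ℝ)))))

end TemporalChangepoint

end

/-! Upper bound. At each dyadic scale `a = 2 ^ k`, contrast the first `a` columns with the last `a`,
using weights of unit Euclidean norm. For every admissible covariance the noise of this contrast has
covariance between `1 - B` and `1 + B` times the identity (`abs_dotProduct_mulVec_sub_le`). Its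
squared norm is therefore known up to a bias of order `B p` and a fluctuation of order `(1 + B) *
scanRate p n`, the two terms of `rhoTemp ^ 2`. There are of order log n scales, so the union bound
costs `loglog n` in the exponent. A change at `t₀` is caught at the scale comparable to `min t₀ (n -
t₀)`.

Lower bound. The larger of the two terms is at least half of `rhoTemp ^ 2`, and each has its own
construction.

For `B p`, a Gaussian random mean is indistinguishable from correlated noise. Let `u` be the sign
pattern of a change in the middle. A random constant mean with noise spiked along `u` has the same
law as a random mean along `u` with noise spiked along the constant vector. The latter mean is a
large change unless a chi-square variable is small, which is unlikely for large `p`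
(`one_sub_exp_le_minimaxError`).

For `(1 + B) * scanRate p n`, noise that is constant on blocks of length `m` of order `1 + B` is
admissible. It leaves about `n / m` independent columns and multiplies the undetectable energy by
`m`. A change with random signs after `2 ^ k` blocks, `k` uniform over `K` scales, has correlations
decaying geometrically between scales, so the second moment of the likelihood ratio is at most `1 +
8 (exp lam - 1) / K` (`one_sub_le_minimaxError`). The bound on `B` keeps `m` of order at most √n,
hence `K` of order log n. -/

noncomputable section

namespace TemporalChangepoint

open scoped RealInnerProductSpace
open Real

/-! ### Exponential moments of centred Gaussian measures -/

section GaussianTools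

variable {E : Type*} [NormedAddCommGroup E] [InnerProductSpace ℝ E] [FiniteDimensional ℝ E]
  [MeasurableSpace E] [BorelSpace E]

lemma map_inner_of_isGaussian (μ : Measure E) [IsGaussian μ] (hμ : μ[id] = 0) (t : E) :
    μ.map (fun x => ⟪t, x⟫) = gaussianReal 0 (covarianceBilin μ t t).toNNReal := by
  have h := IsGaussian.map_eq_gaussianReal (μ := μ) (innerSL ℝ t)
  rw [covarianceBilin_self IsGaussian.memLp_two_id]
  have h0 : ∫ x, (innerSL ℝ t) x ∂μ = 0 := by
    rw [ContinuousLinearMap.integral_comp_id_comm IsGaussian.integrable_id]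
    simp only [id] at hμ
    simp [hμ]
  rw [h0] at h
  exact h

lemma integrable_exp_inner (μ : Measure E) [IsGaussian μ] (hμ : μ[id] = 0) (t : E) :
    Integrable (fun x => exp ⟪t, x⟫) μ := by
  have h := integrable_exp_mul_gaussianReal (μ := 0) (v := (covarianceBilin μ t t).toNNReal) 1
  rw [← map_inner_of_isGaussian μ hμ t, integrable_map_measure (by fun_prop) (by fun_prop)] at h
  simpa [Function.comp_def] using h

lemma integral_exp_inner (μ : Measure E) [IsGaussian μ] (hμ : μ[id] = 0) (t : E) :
    ∫ x, exp ⟪t, x⟫ ∂μ = exp (covarianceBilin μ t t / 2) := by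
  have h := mgf_gaussianReal (map_inner_of_isGaussian μ hμ t) 1
  simpa [mgf, Real.coe_toNNReal _ (covarianceBilin_self_nonneg (μ := μ) t)] using h

lemma lintegral_exp_inner (μ : Measure E) [IsGaussian μ] (hμ : μ[id] = 0) (t : E) :
    ∫⁻ x, ENNReal.ofReal (exp ⟪t, x⟫) ∂μ = ENNReal.ofReal (exp (covarianceBilin μ t t / 2)) := by
  rw [← ofReal_integral_eq_lintegral_ofReal (integrable_exp_inner μ hμ t)
    (ae_of_all _ fun _ => (exp_pos _).le), integral_exp_inner μ hμ]

lemma charFun_of_isGaussian (μ : Measure E) [IsGaussian μ] (hμ : μ[id] = 0) (t : E) :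
    charFun μ t = (exp (-(covarianceBilin μ t t) / 2) : ℝ) := by
  rw [IsGaussian.charFun_eq', hμ]
  push_cast
  simp [neg_div]

lemma covarianceBilin_stdGaussian_self (t : E) :
    covarianceBilin (stdGaussian E) t t = ‖t‖ ^ 2 := by
  rw [covarianceBilin_stdGaussian, innerSL_apply_apply, real_inner_self_eq_norm_sq]

lemma integral_id_stdGaussian_eq_zero : (stdGaussian E)[id] = 0 := by simp

/-- Linearisation of `exp (a ‖x‖²)` and comparison of a centred Gaussian measure with a multiple
of the standard one. -/
lemma lintegral_exp_sq_norm_le (μ : Measure E) [IsGaussian μ] (hμ : μ[id] = 0) {v a : ℝ}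
    (ha : 0 ≤ a) (hv : ∀ t, covarianceBilin μ t t ≤ v * ‖t‖ ^ 2) :
    ∫⁻ x, ENNReal.ofReal (exp (a * ‖x‖ ^ 2)) ∂μ ≤
      ∫⁻ x, ENNReal.ofReal (exp (a * v * ‖x‖ ^ 2)) ∂(stdGaussian E) := by
  have key (x : E) : ENNReal.ofReal (exp (a * ‖x‖ ^ 2)) =
      ∫⁻ y, ENNReal.ofReal (exp ⟪√(2 * a) • x, y⟫) ∂(stdGaussian E) := by
    rw [lintegral_exp_inner _ integral_id_stdGaussian_eq_zero, covarianceBilin_stdGaussian_self,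
      norm_smul, mul_pow]
    congr 2
    rw [norm_eq_abs, sq_abs, sq_sqrt (by positivity)]
    ring
  simp_rw [key]
  -- Tonelli exchanges the roles of `μ` and the standard Gaussian; no integrability is needed, as
  -- both sides may be infinite.
  rw [lintegral_lintegral_swap (by fun_prop)]
  refine lintegral_mono fun y => ?_
  have : ∀ x, ⟪√(2 * a) • x, y⟫ = ⟪√(2 * a) • y, x⟫ := fun x => by
    rw [real_inner_smul_left, real_inner_smul_left, real_inner_comm]
  simp_rw [this]
  rw [lintegral_exp_inner _ hμ]
  refine ENNReal.ofReal_le_ofReal (exp_le_exp.2 ?_)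
  have h := hv (√(2 * a) • y)
  rw [norm_smul, mul_pow, norm_eq_abs, sq_abs, sq_sqrt (by positivity)] at h
  linarith

lemma integrable_exp_neg_sq_norm (μ : Measure E) [IsFiniteMeasure μ] {a : ℝ} (ha : 0 ≤ a) :
    Integrable (fun x => exp (-a * ‖x‖ ^ 2)) μ := by
  refine (integrable_const (1 : ℝ)).mono' (by fun_prop) (ae_of_all _ fun x => ?_)
  rw [norm_eq_abs, abs_of_pos (exp_pos _), exp_le_one_iff]
  nlinarith [mul_nonneg ha (sq_nonneg ‖x‖)]

/-- Fourier analogue of the preceding comparison: `exp (-a ‖x‖²)` is a standard Gaussian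
characteristic function, and Fubini moves the integral over `μ` inside, where it becomes the
characteristic function of `μ`. -/
lemma integral_exp_neg_sq_norm_le (μ : Measure E) [IsGaussian μ] (hμ : μ[id] = 0) {v a : ℝ}
    (ha : 0 ≤ a) (hv0 : 0 ≤ v) (hv : ∀ t, v * ‖t‖ ^ 2 ≤ covarianceBilin μ t t) :
    ∫ x, exp (-a * ‖x‖ ^ 2) ∂μ ≤ ∫ x, exp (-(a * v) * ‖x‖ ^ 2) ∂(stdGaussian E) := by
  have key (ν : Measure E) [IsGaussian ν] (hν : ν[id] = 0) (x : E) :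
      ∫ y, Complex.exp (⟪y, √(2 * a) • x⟫ * Complex.I) ∂ν =
        (exp (-a * covarianceBilin ν x x) : ℝ) := by
    rw [← charFun_apply, charFun_of_isGaussian ν hν]
    congr 2
    rw [map_smul, map_smul, smul_apply, smul_eq_mul, smul_eq_mul, ← mul_assoc,
      mul_self_sqrt (by positivity)]
    ring
  have h1 : ∫ x, exp (-a * ‖x‖ ^ 2) ∂μ =
      ∫ x, exp (-a * covarianceBilin μ x x) ∂(stdGaussian E) := by
    apply Complex.ofReal_injective
    rw [← integral_complex_ofReal, ← integral_complex_ofReal]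
    simp_rw [← key μ hμ]
    have h2 (x : E) : ((exp (-a * ‖x‖ ^ 2) : ℝ) : ℂ) =
        ∫ y, Complex.exp (⟪x, √(2 * a) • y⟫ * Complex.I) ∂(stdGaussian E) := by
      rw [← covarianceBilin_stdGaussian_self, ← key _ integral_id_stdGaussian_eq_zero]
      simp_rw [real_inner_smul_right, real_inner_comm]
    simp_rw [h2]
    refine integral_integral_swap ?_
    refine (integrable_const (1 : ℝ)).mono' (by fun_prop) (ae_of_all _ fun x => ?_)
    simp [Function.uncurry, Complex.norm_exp_ofReal_mul_I]
  rw [h1]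
  refine integral_mono_of_nonneg (ae_of_all _ fun _ => (exp_pos _).le)
    (integrable_exp_neg_sq_norm _ (mul_nonneg ha hv0)) (ae_of_all _ fun x => ?_)
  refine exp_le_exp.2 ?_
  nlinarith [mul_le_mul_of_nonneg_left (hv x) ha]

end GaussianTools

/-! ### Chi-square moment generating function and Cameron–Martin formula -/

section StdGaussian

variable {ι : Type*} [Fintype ι]

lemma integrable_exp_mul_sq_gaussianReal {a : ℝ} (ha : a < 1 / 2) :
    Integrable (fun x : ℝ => exp (a * x ^ 2)) (gaussianReal 0 1) := by
  have h := (integrable_exp_neg_mul_sq (show 0 < 1 / 2 - a by linarith)).const_mul (√(2 * π))⁻¹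
  rw [gaussianReal_of_var_ne_zero _ one_ne_zero,
    integrable_withDensity_iff_integrable_smul' (by fun_prop)
      (ae_of_all _ fun x => gaussianPDF_lt_top)]
  refine h.congr (ae_of_all _ fun x => ?_)
  simp only [toReal_gaussianPDF, gaussianPDFReal, smul_eq_mul, NNReal.coe_one, mul_one, sub_zero]
  rw [mul_assoc, ← exp_add]
  congr 2
  ring

lemma integral_exp_mul_sq_gaussianReal {a : ℝ} (ha : a < 1 / 2) :
    ∫ x : ℝ, exp (a * x ^ 2) ∂(gaussianReal 0 1) = (√(1 - 2 * a))⁻¹ := by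
  rw [integral_gaussianReal_eq_integral_smul one_ne_zero]
  have : ∀ x : ℝ, gaussianPDFReal 0 1 x • exp (a * x ^ 2) =
      (√(2 * π))⁻¹ * exp (-(1 / 2 - a) * x ^ 2) := fun x => by
    simp only [gaussianPDFReal, smul_eq_mul, NNReal.coe_one, mul_one, sub_zero]
    rw [mul_assoc, ← exp_add]
    congr 2
    ring
  simp_rw [this]
  rw [integral_const_mul, integral_gaussian, ← sqrt_inv, ← sqrt_inv, ← sqrt_mul (by positivity)]
  congr 1
  have : 1 / 2 - a ≠ 0 := by linarith
  have : 1 - 2 * a ≠ 0 := by linarith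
  field_simp

lemma integrable_exp_mul_sq_norm_stdGaussian {a : ℝ} (ha : a < 1 / 2) :
    Integrable (fun x : EuclideanSpace ℝ ι => exp (a * ‖x‖ ^ 2)) (stdGaussian _) := by
  rw [← map_pi_eq_stdGaussian, integrable_map_measure (by fun_prop) (by fun_prop)]
  simp only [Function.comp_def, EuclideanSpace.real_norm_sq_eq, Finset.mul_sum, exp_sum]
  exact Integrable.fintype_prod fun i => integrable_exp_mul_sq_gaussianReal ha

lemma integral_exp_mul_sq_norm_stdGaussian {a : ℝ} (ha : a < 1 / 2) :
    ∫ x : EuclideanSpace ℝ ι, exp (a * ‖x‖ ^ 2) ∂(stdGaussian _) =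
      (√(1 - 2 * a))⁻¹ ^ Fintype.card ι := by
  rw [← map_pi_eq_stdGaussian, integral_map (by fun_prop) (by fun_prop)]
  simp only [EuclideanSpace.real_norm_sq_eq, Finset.mul_sum, exp_sum]
  rw [integral_fintype_prod_eq_prod (fun _ x => exp (a * x ^ 2))]
  simp [integral_exp_mul_sq_gaussianReal ha]

lemma exp_neg_add_sq_le {u : ℝ} (hu : u ≤ 1 / 2) : exp (-(u + u ^ 2)) ≤ 1 - u := by
  rw [exp_neg, inv_le_comm₀ (exp_pos _) (by linarith), inv_le_iff_one_le_mul₀ (by linarith)]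
  -- The linear bound on `exp` yields `1 - u ^ 3` after multiplication by `1 - u`, which suffices
  -- only for `u ≤ 0`; positive `u` needs the quadratic term.
  rcases le_total u 0 with h | h
  · have h1 := add_one_le_exp (u + u ^ 2)
    have h2 := mul_le_mul_of_nonneg_right h1 (show 0 ≤ 1 - u by linarith)
    nlinarith [mul_nonneg (neg_nonneg.2 h) (sq_nonneg u)]
  · have h1 := quadratic_le_exp_of_nonneg (show 0 ≤ u + u ^ 2 by positivity)
    have h2 := mul_le_mul_of_nonneg_right h1 (show 0 ≤ 1 - u by linarith)
    have h3 : 0 ≤ -u + (1 - u) * (1 + u) ^ 2 / 2 := by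
      nlinarith [mul_nonneg h (show 0 ≤ 1 / 2 - u by linarith),
        mul_nonneg (mul_nonneg h h) (show 0 ≤ 1 / 2 - u by linarith)]
    nlinarith [mul_nonneg (sq_nonneg u) h3]

/-- Negative `a` is allowed, so the same estimate serves the upper and the lower chi-square tails.
-/
lemma integral_exp_mul_sq_norm_stdGaussian_le {a : ℝ} (ha : a ≤ 1 / 4) :
    ∫ x : EuclideanSpace ℝ ι, exp (a * ‖x‖ ^ 2) ∂(stdGaussian _) ≤
      exp (Fintype.card ι * (a + 2 * a ^ 2)) := by
  rw [integral_exp_mul_sq_norm_stdGaussian (by linarith), exp_nat_mul]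
  refine pow_le_pow_left₀ (by positivity) ?_ _
  have h1 : exp (-(a + 2 * a ^ 2)) ≤ √(1 - 2 * a) := by
    refine le_sqrt_of_sq_le ?_
    rw [← exp_nat_mul]
    have := exp_neg_add_sq_le (u := 2 * a) (by linarith)
    convert this using 2
    push_cast
    ring
  rw [← neg_neg (a + 2 * a ^ 2), exp_neg]
  exact inv_anti₀ (exp_pos _) h1

/-- The Cameron–Martin formula for the standard Gaussian measure. -/
lemma map_add_stdGaussian (η : EuclideanSpace ℝ ι) :
    (stdGaussian (EuclideanSpace ℝ ι)).map (fun z => η + z) =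
      (stdGaussian (EuclideanSpace ℝ ι)).withDensity
        (fun z => ENNReal.ofReal (exp (⟪η, z⟫ - ‖η‖ ^ 2 / 2))) := by
  have hint : Integrable (fun z => exp (⟪η, z⟫ - ‖η‖ ^ 2 / 2))
      (stdGaussian (EuclideanSpace ℝ ι)) := by
    simp_rw [exp_sub]
    exact (integrable_exp_inner _ integral_id_stdGaussian_eq_zero η).div_const _
  have : IsFiniteMeasure ((stdGaussian (EuclideanSpace ℝ ι)).withDensity
        (fun z => ENNReal.ofReal (exp (⟪η, z⟫ - ‖η‖ ^ 2 / 2)))) :=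
    isFiniteMeasure_withDensity_ofReal hint.2
  apply Measure.ext_of_charFun
  ext t
  rw [charFun_map_const_add, charFun_stdGaussian, charFun_apply,
    integral_withDensity_eq_integral_toReal_smul (by fun_prop) (ae_of_all _ fun _ => by simp),
    ← map_pi_eq_stdGaussian, integral_map (by fun_prop) (by fun_prop)]
  have h1 (x : ι → ℝ) : (ENNReal.ofReal (exp (⟪η, WithLp.toLp 2 x⟫ - ‖η‖ ^ 2 / 2))).toReal •
      Complex.exp (⟪WithLp.toLp 2 x, t⟫ * Complex.I) = Complex.exp (-(‖η‖ ^ 2 / 2 : ℝ)) *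
        ∏ i, Complex.exp ((η i + t i * Complex.I) * x i) := by
    rw [ENNReal.toReal_ofReal (exp_pos _).le, Complex.real_smul, Complex.ofReal_exp,
      ← Complex.exp_add, ← Complex.exp_sum, ← Complex.exp_add]
    congr 1
    simp only [PiLp.inner_apply, RCLike.inner_apply, conj_trivial]
    push_cast
    rw [Finset.sum_mul, sub_add_eq_add_sub, ← Finset.sum_add_distrib, sub_eq_add_neg, add_comm]
    congr 1
    refine Finset.sum_congr rfl fun i _ => ?_
    ring
  simp_rw [h1]
  rw [integral_const_mul,
    integral_fintype_prod_eq_prod (fun i (x : ℝ) => Complex.exp ((η i + t i * Complex.I) * x))]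
  -- Tilting and Fourier transform combine, in each coordinate, into the complex moment generating
  -- function at `η i + t i * I`.
  have h2 (i : ι) : ∫ x : ℝ, Complex.exp ((η i + t i * Complex.I) * x) ∂(gaussianReal 0 1) =
      Complex.exp ((η i + t i * Complex.I) ^ 2 / 2) := by
    have := complexMGF_id_gaussianReal (μ := 0) (v := 1) (η i + t i * Complex.I)
    simpa [complexMGF] using this
  simp_rw [h2]
  rw [← Complex.exp_sum, ← Complex.exp_add, ← Complex.exp_add]
  congr 1
  simp only [PiLp.inner_apply, RCLike.inner_apply, conj_trivial, ← Complex.ofReal_pow,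
    EuclideanSpace.real_norm_sq_eq]
  push_cast
  rw [Finset.sum_mul, neg_div, Finset.sum_div, Finset.sum_div, ← Finset.sum_neg_distrib,
    ← Finset.sum_neg_distrib, ← Finset.sum_add_distrib, ← Finset.sum_add_distrib]
  refine Finset.sum_congr rfl fun i _ => ?_
  ring_nf
  rw [Complex.I_sq]
  ring

lemma integral_comp_add_stdGaussian (η : EuclideanSpace ℝ ι) {f : EuclideanSpace ℝ ι → ℝ}
    (hf : Measurable f) :
    ∫ z, f (η + z) ∂(stdGaussian (EuclideanSpace ℝ ι)) =
      ∫ z, exp (⟪η, z⟫ - ‖η‖ ^ 2 / 2) * f z ∂(stdGaussian (EuclideanSpace ℝ ι)) := by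
  rw [← integral_map (φ := fun z => η + z) (by fun_prop) (by fun_prop), map_add_stdGaussian,
    integral_withDensity_eq_integral_toReal_smul (by fun_prop) (ae_of_all _ fun _ => by simp)]
  simp [ENNReal.toReal_ofReal (exp_pos _).le]

end StdGaussian

/-! ### Tail bounds for Gaussian vectors with bounded covariance -/

section Tails

variable {p : ℕ} (μ : Measure (EuclideanSpace ℝ (Fin p))) [IsGaussian μ]

/-- Chernoff bound at exponent `a / v`, which the comparison with the standard Gaussian turns into
`a`. The choice of `a` is left to the application. -/
lemma measureReal_sq_norm_ge_le (hμ : μ[id] = 0) {v a y : ℝ}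
    (hv0 : 0 < v) (hv : ∀ t, covarianceBilin μ t t ≤ v * ‖t‖ ^ 2) (ha : 0 ≤ a) (ha' : a ≤ 1 / 4) :
    μ.real {x | v * (p + y) ≤ ‖x‖ ^ 2} ≤ exp (2 * a ^ 2 * p - a * y) := by
  have h1 := lintegral_exp_sq_norm_le μ hμ (div_nonneg ha hv0.le) hv
  rw [div_mul_cancel₀ _ hv0.ne', ← ofReal_integral_eq_lintegral_ofReal
    (integrable_exp_mul_sq_norm_stdGaussian (by linarith)) (ae_of_all _ fun _ => (exp_pos _).le)]
    at h1
  have h2 := h1.trans (ENNReal.ofReal_le_ofReal (integral_exp_mul_sq_norm_stdGaussian_le ha'))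
  rw [Fintype.card_fin] at h2
  have h3 := mul_meas_ge_le_lintegral (μ := μ)
    (f := fun x => ENNReal.ofReal (exp (a / v * ‖x‖ ^ 2))) (by fun_prop)
    (ENNReal.ofReal (exp (a * (p + y))))
  have h4 : μ {x | v * (p + y) ≤ ‖x‖ ^ 2} ≤
      μ {x | ENNReal.ofReal (exp (a * (p + y))) ≤ ENNReal.ofReal (exp (a / v * ‖x‖ ^ 2))} := by
    refine measure_mono fun x hx => ?_
    refine ENNReal.ofReal_le_ofReal (exp_le_exp.2 ?_)
    have := mul_le_mul_of_nonneg_left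
      (show v * (p + y) ≤ ‖x‖ ^ 2 from hx) (div_nonneg ha hv0.le)
    rwa [← mul_assoc, div_mul_cancel₀ _ hv0.ne'] at this
  have h5 := (mul_le_mul_right h4 (ENNReal.ofReal (exp (a * (p + y))))).trans (h3.trans h2)
  rw [← ofReal_measureReal, ← ENNReal.ofReal_mul (exp_pos _).le,
    ENNReal.ofReal_le_ofReal_iff (exp_pos _).le, mul_comm, ← le_div_iff₀ (exp_pos _),
    ← exp_sub] at h5
  refine h5.trans_eq ?_
  ring_nf

/-- Chernoff bound for the lower tail; `v ≤ 1` absorbs the factor `v ^ 2` of the second-order term.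
It is applied with `v = 1 - B`. -/
lemma measureReal_sq_norm_le_le (hμ : μ[id] = 0) {v a y : ℝ} (hv0 : 0 ≤ v) (hv1 : v ≤ 1)
    (hv : ∀ t, v * ‖t‖ ^ 2 ≤ covarianceBilin μ t t) (ha : 0 ≤ a) :
    μ.real {x | ‖x‖ ^ 2 ≤ v * p - y} ≤ exp (2 * a ^ 2 * p - a * y) := by
  have h1 := integral_exp_neg_sq_norm_le μ hμ ha hv0 hv
  have h2 := h1.trans (integral_exp_mul_sq_norm_stdGaussian_le (by nlinarith))
  rw [Fintype.card_fin] at h2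
  have h3 := mul_meas_ge_le_integral_of_nonneg (μ := μ)
    (ae_of_all _ fun x => (exp_pos (-a * ‖x‖ ^ 2)).le) (integrable_exp_neg_sq_norm μ ha)
    (exp (-a * (v * p - y)))
  have h4 : μ.real {x | ‖x‖ ^ 2 ≤ v * p - y} ≤
      μ.real {x | exp (-a * (v * p - y)) ≤ exp (-a * ‖x‖ ^ 2)} := by
    refine measureReal_mono fun x hx => exp_le_exp.2 ?_
    have := mul_le_mul_of_nonneg_left (show ‖x‖ ^ 2 ≤ v * p - y from hx) ha
    linarith
  have h5 := (mul_le_mul_of_nonneg_left h4 (exp_pos (-a * (v * p - y))).le).trans (h3.trans h2)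
  rw [mul_comm, ← le_div_iff₀ (exp_pos _), ← exp_sub] at h5
  refine h5.trans (exp_le_exp.2 ?_)
  have : v ^ 2 * (a ^ 2 * p) ≤ 1 * (a ^ 2 * p) :=
    mul_le_mul_of_nonneg_right (by nlinarith) (by positivity)
  nlinarith

lemma measureReal_inner_le_neg_le (hμ : μ[id] = 0) {v s : ℝ} (hs : 0 < s)
    (hv : ∀ t, covarianceBilin μ t t ≤ v * ‖t‖ ^ 2) (d : EuclideanSpace ℝ (Fin p)) :
    μ.real {x | ⟪d, x⟫ ≤ -s} ≤ v * ‖d‖ ^ 2 / s ^ 2 := by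
  have hm : MemLp (fun x => ⟪d, x⟫) 2 μ := (IsGaussian.memLp_two_id (μ := μ)).const_inner d
  have h0 : ∫ x, ⟪d, x⟫ ∂μ = 0 := by
    rw [integral_inner IsGaussian.integrable_fun_id]
    simp only [id] at hμ
    simp [hμ]
  have h1 := meas_ge_le_variance_div_sq hm hs
  rw [h0, ← covarianceBilin_self IsGaussian.memLp_two_id] at h1
  have h2 : μ {x | ⟪d, x⟫ ≤ -s} ≤ μ {x | s ≤ |⟪d, x⟫ - 0|} := by
    refine measure_mono fun x hx => ?_
    have : ⟪d, x⟫ ≤ -s := hx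
    rw [Set.mem_ofPred_eq, sub_zero, le_abs]
    right
    linarith
  have h3 := h2.trans (h1.trans (ENNReal.ofReal_le_ofReal
    (div_le_div_of_nonneg_right (hv d) (sq_nonneg s))))
  have : 0 ≤ v * ‖d‖ ^ 2 / s ^ 2 :=
    div_nonneg ((covarianceBilin_self_nonneg d).trans (hv d)) (sq_nonneg s)
  rwa [← ofReal_measureReal, ENNReal.ofReal_le_ofReal_iff this] at h3

end Tails

/-! ### Weighted column sums and their covariance -/

section Contrast

variable {p n : ℕ}

/-- The weighted sum `∑ₜ wₜ Xₜ` of the columns of `X`. -/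
def columnSum (w : Fin n → ℝ) : Mat p n →L[ℝ] EuclideanSpace ℝ (Fin p) :=
  LinearMap.toContinuousLinearMap
    { toFun := fun X => WithLp.toLp 2 fun j => ∑ t, w t * X (j, t)
      map_add' := fun X Y => by ext j; simp [mul_add, Finset.sum_add_distrib]
      map_smul' := fun c X => by ext j; simp [Finset.mul_sum, mul_left_comm] }

@[simp]
lemma columnSum_apply (w : Fin n → ℝ) (X : Mat p n) (j : Fin p) :
    columnSum w X j = ∑ t, w t * X (j, t) := rfl

lemma adjoint_columnSum_apply (w : Fin n → ℝ) (ξ : EuclideanSpace ℝ (Fin p)) :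
    (columnSum w).adjoint ξ = WithLp.toLp 2 fun i : Fin p × Fin n => w i.2 * ξ i.1 := by
  refine ext_inner_right ℝ fun X => ?_
  rw [ContinuousLinearMap.adjoint_inner_left]
  simp only [PiLp.inner_apply, columnSum_apply, RCLike.inner_apply, conj_trivial,
    Fintype.sum_prod_type, Finset.sum_mul]
  refine Finset.sum_congr rfl fun j _ => Finset.sum_congr rfl fun t _ => ?_
  ring

lemma block_comm_of_isHermitian {S : Matrix (Fin p × Fin n) (Fin p × Fin n) ℝ}
    (hS : S.IsHermitian) (s t : Fin n) : block S t s = (block S s t).conjTranspose := by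
  ext i j
  simp only [block, Matrix.of_apply, Matrix.conjTranspose_apply]
  exact (hS.apply _ _).symm

lemma opNorm_conjTranspose (A : Matrix (Fin p) (Fin p) ℝ) : opNorm A.conjTranspose = opNorm A := by
  unfold opNorm
  rw [← Matrix.star_eq_conjTranspose, map_star, ContinuousLinearMap.star_eq_adjoint,
    LinearIsometryEquiv.norm_map]

lemma abs_inner_toEuclideanCLM_le (A : Matrix (Fin p) (Fin p) ℝ)
    (ξ : EuclideanSpace ℝ (Fin p)) :
    |⟪ξ, Matrix.toEuclideanCLM (𝕜 := ℝ) A ξ⟫| ≤ opNorm A * ‖ξ‖ ^ 2 := by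
  refine (abs_real_inner_le_norm _ _).trans ?_
  have := (Matrix.toEuclideanCLM (n := Fin p) (𝕜 := ℝ) A).le_opNorm ξ
  unfold opNorm
  nlinarith [norm_nonneg ξ]

lemma dotProduct_mulVec_kronecker (S : Matrix (Fin p × Fin n) (Fin p × Fin n) ℝ)
    (w : Fin n → ℝ) (ξ : EuclideanSpace ℝ (Fin p)) :
    (fun i : Fin p × Fin n => w i.2 * ξ i.1) ⬝ᵥ
        S.mulVec (fun i : Fin p × Fin n => w i.2 * ξ i.1) =
      ∑ s, ∑ t, w s * w t * ⟪ξ, Matrix.toEuclideanCLM (𝕜 := ℝ) (block S s t) ξ⟫ := by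
  simp only [Matrix.inner_toEuclideanCLM, dotProduct, Matrix.mulVec, Fintype.sum_prod_type, block,
    Matrix.of_apply, Finset.mul_sum]
  rw [Finset.sum_comm]
  refine Finset.sum_congr rfl fun s _ => ?_
  rw [Finset.sum_comm_cycle]
  refine Finset.sum_congr rfl fun t _ => Finset.sum_congr rfl fun i _ =>
    Finset.sum_congr rfl fun j _ => ?_
  ring

/-- A Schur test: the diagonal blocks contribute exactly `‖ξ‖ ^ 2`, and `|w s * w t| ≤ (w s ^ 2 + w
t ^ 2) / 2` reduces the rest to row and column sums of operator norms, which agree by symmetry of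
the covariance. -/
lemma abs_dotProduct_mulVec_sub_le {B : ℝ} {S : Matrix (Fin p × Fin n) (Fin p × Fin n) ℝ}
    (hS : S ∈ covClass p n B) {w : Fin n → ℝ} (hw : ∑ t, w t ^ 2 = 1)
    (ξ : EuclideanSpace ℝ (Fin p)) :
    |(fun i : Fin p × Fin n => w i.2 * ξ i.1) ⬝ᵥ
        S.mulVec (fun i : Fin p × Fin n => w i.2 * ξ i.1) - ‖ξ‖ ^ 2| ≤ B * ‖ξ‖ ^ 2 := by
  obtain ⟨hpsd, hdiag, hoff⟩ := hS
  set q : Fin n → Fin n → ℝ := fun s t => ⟪ξ, Matrix.toEuclideanCLM (𝕜 := ℝ) (block S s t) ξ⟫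
    with hq
  set o : Fin n → Fin n → ℝ := fun s t => opNorm (block S s t) with ho
  have hosymm (s t) : o s t = o t s := by
    simp only [ho]
    rw [block_comm_of_isHermitian hpsd.1 t s, opNorm_conjTranspose]
  have hqo (s t) : |q s t| ≤ o s t * ‖ξ‖ ^ 2 := abs_inner_toEuclideanCLM_le _ _
  have ho0 (s t) : 0 ≤ o s t := norm_nonneg _
  have hqd (t) : q t t = ‖ξ‖ ^ 2 := by
    simp [hq, hdiag]
  have hsplit : ∑ s, ∑ t, w s * w t * q s t - ‖ξ‖ ^ 2 =
      ∑ t, ∑ s ∈ Finset.univ.erase t, w s * w t * q s t := by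
    rw [Finset.sum_comm, sub_eq_iff_eq_add]
    rw [show ‖ξ‖ ^ 2 = ∑ t, w t ^ 2 * ‖ξ‖ ^ 2 by rw [← Finset.sum_mul, hw, one_mul],
      ← Finset.sum_add_distrib]
    refine Finset.sum_congr rfl fun t _ => ?_
    rw [← Finset.sum_erase_add _ _ (Finset.mem_univ t), hqd]
    ring
  rw [dotProduct_mulVec_kronecker, hsplit]
  have h1 (t) : |∑ s ∈ Finset.univ.erase t, w s * w t * q s t| ≤
      ∑ s ∈ Finset.univ.erase t, (w s ^ 2 / 2 + w t ^ 2 / 2) * (o s t * ‖ξ‖ ^ 2) := by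
    refine (Finset.abs_sum_le_sum_abs _ _).trans (Finset.sum_le_sum fun s _ => ?_)
    rw [abs_mul]
    refine mul_le_mul ?_ (hqo s t) (abs_nonneg _) (by positivity)
    rw [abs_le]
    constructor <;> nlinarith [sq_nonneg (w s + w t), sq_nonneg (w s - w t)]
  have h2 : ∑ t, ∑ s ∈ Finset.univ.erase t, w t ^ 2 * o s t ≤ B := by
    calc _ = ∑ t, w t ^ 2 * ∑ s ∈ Finset.univ.erase t, o s t := by simp_rw [Finset.mul_sum]
      _ ≤ ∑ t, w t ^ 2 * B :=
        Finset.sum_le_sum fun t _ => mul_le_mul_of_nonneg_left (hoff t) (sq_nonneg _)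
      _ = B := by rw [← Finset.sum_mul, hw, one_mul]
  have h3 : ∑ t, ∑ s ∈ Finset.univ.erase t, w s ^ 2 * o s t =
      ∑ t, ∑ s ∈ Finset.univ.erase t, w t ^ 2 * o s t := by
    rw [Finset.sum_comm' (t' := Finset.univ) (s' := fun s => Finset.univ.erase s)
      (by simp [eq_comm])]
    simp_rw [hosymm]
  calc _ ≤ ∑ t, ∑ s ∈ Finset.univ.erase t, (w s ^ 2 / 2 + w t ^ 2 / 2) * (o s t * ‖ξ‖ ^ 2) :=
        (Finset.abs_sum_le_sum_abs _ _).trans (Finset.sum_le_sum fun t _ => h1 t)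
    _ = (∑ t, ∑ s ∈ Finset.univ.erase t, w s ^ 2 * o s t +
        ∑ t, ∑ s ∈ Finset.univ.erase t, w t ^ 2 * o s t) / 2 * ‖ξ‖ ^ 2 := by
      simp_rw [← Finset.sum_add_distrib, Finset.sum_div, Finset.sum_mul]
      refine Finset.sum_congr rfl fun t _ => Finset.sum_congr rfl fun s _ => ?_
      ring
    _ ≤ B * ‖ξ‖ ^ 2 := by
      rw [h3]
      exact mul_le_mul_of_nonneg_right (by linarith) (sq_nonneg _)

instance isGaussian_law (θ : Mat p n) (S : Matrix (Fin p × Fin n) (Fin p × Fin n) ℝ) :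
    IsGaussian (law θ S) :=
  isGaussian_multivariateGaussian

lemma integral_id_map_columnSum (S : Matrix (Fin p × Fin n) (Fin p × Fin n) ℝ) (w : Fin n → ℝ) :
    ((law 0 S).map (columnSum w))[id] = 0 := by
  simp only [id]
  rw [integral_map (by fun_prop) (by fun_prop),
    ContinuousLinearMap.integral_comp_id_comm IsGaussian.integrable_id]
  simp [law]

lemma covarianceBilin_map_columnSum {S : Matrix (Fin p × Fin n) (Fin p × Fin n) ℝ}
    (hS : S.PosSemidef) (w : Fin n → ℝ) (ξ : EuclideanSpace ℝ (Fin p)) :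
    covarianceBilin ((law 0 S).map (columnSum w)) ξ ξ =
      (fun i : Fin p × Fin n => w i.2 * ξ i.1) ⬝ᵥ
        S.mulVec (fun i : Fin p × Fin n => w i.2 * ξ i.1) := by
  rw [covarianceBilin_map IsGaussian.memLp_two_id, law, covarianceBilin_multivariateGaussian hS,
    adjoint_columnSum_apply]

lemma law_eq_map (θ : Mat p n) (S : Matrix (Fin p × Fin n) (Fin p × Fin n) ℝ) :
    law θ S = (law 0 S).map (fun X => θ + X) := by
  unfold law multivariateGaussian
  rw [Measure.map_map (by fun_prop) (by fun_prop)]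
  simp [Function.comp_def]

end Contrast

/-! ### The rate `scanRate` and the Chernoff exponent -/

section Rate

/-- `log log (8n)`. -/
def loglog (n : ℕ) : ℝ := log (log (8 * (n : ℝ)))

/-- `max (√(p log log (8n))) (log log (8n))`. -/
def scanRate (p n : ℕ) : ℝ := max (√((p : ℝ) * loglog n)) (loglog n)

variable {p n : ℕ} {B : ℝ}

/-- The factor 8 inside the logarithm ensures this already at `n = 2`, since log 16 > e. -/
lemma one_le_loglog (hn : 2 ≤ n) : 1 ≤ loglog n := by
  have h16 : (16 : ℝ) ≤ 8 * n := by
    have : (2 : ℝ) ≤ n := by exact_mod_cast hn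
    linarith
  have h1 : exp 1 ≤ log (8 * n) := by
    calc exp 1 ≤ 4 * log 2 := by linarith [exp_one_lt_d9, log_two_gt_d9]
      _ = log 16 := by
        rw [show (16 : ℝ) = 2 ^ 4 by norm_num, log_pow]
        norm_num
      _ ≤ log (8 * n) := log_le_log (by norm_num) h16
  exact (le_log_iff_exp_le ((exp_pos 1).trans_le h1)).2 h1

lemma exp_loglog (hn : 2 ≤ n) : exp (loglog n) = log (8 * n) := by
  have : (2 : ℝ) ≤ n := by exact_mod_cast hn
  exact exp_log (log_pos (by linarith))

lemma loglog_le_scanRate : loglog n ≤ scanRate p n := le_max_right _ _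

lemma one_le_scanRate (hn : 2 ≤ n) : 1 ≤ scanRate p n :=
  (one_le_loglog hn).trans loglog_le_scanRate

lemma rhoTemp_sq (hB : 0 ≤ B) (hn : 2 ≤ n) :
    rhoTemp p n B ^ 2 = B * p + (1 + B) * scanRate p n := by
  have h := one_le_scanRate (p := p) hn
  exact sq_sqrt (add_nonneg (by positivity) (mul_nonneg (by linarith) (zero_le_one.trans h)))

/-- The exponent used in the Chernoff bounds. -/
lemma exists_chernoff_exponent (p : ℕ) (hn : 2 ≤ n) :
    ∃ a : ℝ, 0 ≤ a ∧ a ≤ 1 / 4 ∧ 2 * a ^ 2 * p ≤ loglog n / 8 ∧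
      loglog n / 4 ≤ a * scanRate p n := by
  have hL := one_le_loglog hn
  -- The exponent is `√(loglog n / p) / 4`, balancing `a ^ 2 * p` against `a * √(p * loglog n)`,
  -- capped at 1/4.
  rcases le_total (p : ℝ) (loglog n) with h | h
  · exact ⟨1 / 4, by norm_num, le_rfl, by linarith,
      by linarith [loglog_le_scanRate (p := p) (n := n)]⟩
  · have hp : (0 : ℝ) < p := by linarith
    refine ⟨1 / 4 * √(loglog n / p), by positivity, ?_, ?_, ?_⟩
    · have : √(loglog n / p) ≤ 1 := sqrt_le_one.2 (div_le_one_of_le₀ h hp.le)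
      linarith
    · rw [mul_pow, sq_sqrt (by positivity)]
      field_simp
      norm_num
    · have h1 : √(loglog n / p) * √(p * loglog n) = loglog n := by
        rw [← sqrt_mul (by positivity)]
        have : loglog n / p * (p * loglog n) = loglog n ^ 2 := by field_simp
        rw [this, sqrt_sq (by linarith)]
      have h2 : √(p * loglog n) ≤ scanRate p n := le_max_left _ _
      nlinarith [mul_le_mul_of_nonneg_left h2 (sqrt_nonneg (loglog n / p))]

/-- Bounds the number of scales, that is, the cost of the union bound. -/
lemma natLog_le_two_mul_exp_loglog (hn : 2 ≤ n) : (Nat.log 2 n : ℝ) ≤ 2 * exp (loglog n) := by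
  have h0 : (2 : ℝ) ≤ n := by exact_mod_cast hn
  have h1 : (2 : ℝ) ^ Nat.log 2 n ≤ n := by exact_mod_cast Nat.pow_log_le_self 2 (by omega)
  have h2 := log_le_log (by positivity) h1
  rw [log_pow] at h2
  have h3 : log n ≤ log (8 * n) := log_le_log (by linarith) (by linarith)
  have h4 : (0 : ℝ) ≤ Nat.log 2 n := by positivity
  rw [exp_loglog hn]
  nlinarith [log_two_gt_d9]

end Rate

/-! ### Dyadic contrasts and the signal they retain -/

section Scan

variable {p n : ℕ}

/-- The indicator of the times `t < a`. -/
def firstTimes (n a : ℕ) (t : Fin n) : ℝ := if (t : ℕ) < a then 1 else 0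

lemma sum_firstTimes {a : ℕ} (ha : a ≤ n) : ∑ t, firstTimes n a t = a := by
  have := Fin.sum_univ_eq_sum_range (fun i => if i < a then (1 : ℝ) else 0) n
  simp only [firstTimes]
  rw [this, Finset.sum_boole]
  congr 2
  rw [← Finset.card_range a]
  congr 1
  ext i
  simp
  omega

lemma firstTimes_mul {a b : ℕ} (hab : a ≤ b) (t : Fin n) :
    firstTimes n a t * firstTimes n b t = firstTimes n a t := by
  unfold firstTimes
  split_ifs <;> first | omega | norm_num

/-- The normalised contrast between the first `a` and the last `a` times. -/
def scanWeight (n a : ℕ) (t : Fin n) : ℝ :=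
  (√(2 * a))⁻¹ * (firstTimes n a t + firstTimes n (n - a) t - 1)

lemma sum_scanWeight {a : ℕ} (ha : 2 * a ≤ n) : ∑ t, scanWeight n a t = 0 := by
  simp only [scanWeight]
  rw [← Finset.mul_sum, Finset.sum_sub_distrib, Finset.sum_add_distrib,
    sum_firstTimes (by omega), sum_firstTimes (by omega)]
  rw [Nat.cast_sub (by omega)]
  simp

lemma sum_scanWeight_sq {a : ℕ} (ha0 : 0 < a) (ha : 2 * a ≤ n) :
    ∑ t, scanWeight n a t ^ 2 = 1 := by
  have h (t : Fin n) : scanWeight n a t ^ 2 =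
      (2 * a : ℝ)⁻¹ * (firstTimes n a t + 1 - firstTimes n (n - a) t) := by
    rw [scanWeight, mul_pow, inv_pow, sq_sqrt (by positivity)]
    congr 1
    unfold firstTimes
    split_ifs <;> first | omega | norm_num
  simp_rw [h]
  rw [← Finset.mul_sum, Finset.sum_sub_distrib, Finset.sum_add_distrib,
    sum_firstTimes (by omega), sum_firstTimes (by omega), Nat.cast_sub (by omega)]
  have : (a : ℝ) ≠ 0 := by positivity
  simp
  field_simp
  ring

lemma sum_scanWeight_mul_firstTimes {a t₀ : ℕ} (h1 : a ≤ t₀) (h2 : t₀ ≤ n - a) (ha : 2 * a ≤ n) :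
    ∑ t, scanWeight n a t * firstTimes n t₀ t = (√(2 * a))⁻¹ * a := by
  have h (t : Fin n) : scanWeight n a t * firstTimes n t₀ t =
      (√(2 * a))⁻¹ * firstTimes n a t := by
    rw [scanWeight, mul_assoc, sub_mul, add_mul, firstTimes_mul h1, mul_comm (firstTimes n (n - a) t),
      firstTimes_mul h2]
    ring
  simp_rw [h]
  rw [← Finset.mul_sum, sum_firstTimes (by omega)]

lemma columnSum_scanWeight_of_mem_nullSpace {a : ℕ} (ha : 2 * a ≤ n) {θ : Mat p n}
    (hθ : θ ∈ nullSpace p n) : columnSum (scanWeight n a) θ = 0 := by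
  obtain ⟨μ, hμ⟩ := hθ
  ext j
  simp [hμ, ← Finset.sum_mul, sum_scanWeight ha]

/-- The change point lies between the two windows, so the contrast of the means is `√(a / 2) • (μ₁ -
μ₂)`. Since `t₀ (n - t₀) / n ≤ min t₀ (n - t₀) ≤ 2 * a`, the loss is at most a factor 4. -/
lemma sq_norm_columnSum_scanWeight {a t₀ s : ℕ} {ρ : ℝ} (ha0 : 0 < a) (ha : 2 * a ≤ n)
    (h1 : a ≤ t₀) (h2 : t₀ ≤ n - a) (h3 : min t₀ (n - t₀) ≤ 2 * a) {θ : Mat p n}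
    (hθ : θ ∈ altSpaceAt t₀ p n s ρ) : ρ ^ 2 ≤ 4 * ‖columnSum (scanWeight n a) θ‖ ^ 2 := by
  obtain ⟨μ₁, μ₂, hμ₁, hμ₂, -, hρ⟩ := hθ
  have hd : columnSum (scanWeight n a) θ = ((√(2 * a))⁻¹ * a) • (μ₁ - μ₂) := by
    ext j
    have h (t : Fin n) : scanWeight n a t * θ (j, t) = scanWeight n a t * μ₂ j +
        scanWeight n a t * firstTimes n t₀ t * (μ₁ j - μ₂ j) := by
      unfold firstTimes
      split_ifs with ht
      · rw [hμ₁ j t ht]; ring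
      · rw [hμ₂ j t (by omega)]; ring
    simp only [columnSum_apply, h, Finset.sum_add_distrib, ← Finset.sum_mul, sum_scanWeight ha,
      sum_scanWeight_mul_firstTimes h1 h2 ha]
    simp
  have ha' : (0 : ℝ) < a := by exact_mod_cast ha0
  rw [hd, norm_smul, mul_pow, norm_eq_abs, sq_abs, mul_pow, inv_pow, sq_sqrt (by positivity)]
  have hmin : (t₀ : ℝ) * (n - t₀) / n ≤ 2 * a := by
    have hn : (0 : ℝ) < n := by exact_mod_cast (by omega : 0 < n)
    have ht : (t₀ : ℝ) ≤ n := by exact_mod_cast (by omega : t₀ ≤ n)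
    have ht' : (0 : ℝ) ≤ t₀ := by positivity
    rw [div_le_iff₀ hn]
    rcases min_le_iff.1 h3 with h | h
    · have : (t₀ : ℝ) ≤ 2 * a := by exact_mod_cast h
      nlinarith
    · have : (n : ℝ) - t₀ ≤ 2 * a := by
        rw [← Nat.cast_sub (by omega)]; exact_mod_cast h
      nlinarith
  refine hρ.trans ((mul_le_mul_of_nonneg_right hmin (sq_nonneg _)).trans_eq ?_)
  field_simp
  ring

/-- The scale is the integer part of the binary logarithm of `min t₀ (n - t₀)`; as this minimum is
at most `n / 2`, the scale stays below `Nat.log 2 n`. -/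
lemma exists_scale {t₀ : ℕ} (h1 : 1 ≤ t₀) (h2 : t₀ < n) :
    ∃ k < Nat.log 2 n, 2 ^ k ≤ t₀ ∧ t₀ ≤ n - 2 ^ k ∧ min t₀ (n - t₀) ≤ 2 * 2 ^ k := by
  have hm : min t₀ (n - t₀) ≠ 0 := by omega
  have h3 := Nat.pow_log_le_self 2 hm
  have h4 := Nat.lt_pow_succ_log_self (b := 2) (by norm_num) (min t₀ (n - t₀))
  rw [pow_succ] at h4
  refine ⟨Nat.log 2 (min t₀ (n - t₀)), ?_, by omega, by omega, by omega⟩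
  refine Nat.le_log_of_pow_le (by norm_num) ?_
  rw [Nat.succ_eq_add_one, pow_succ]
  omega

lemma two_mul_pow_le {k : ℕ} (hn : n ≠ 0) (hk : k < Nat.log 2 n) : 2 * 2 ^ k ≤ n := by
  rw [← pow_succ']
  exact Nat.pow_le_of_le_log hn hk

end Scan

/-! ### Errors of the scan test and the upper bound -/

section UpperBound

variable {p n : ℕ} {B : ℝ}

lemma minimaxError_le {ρ r₀ r₁ : ℝ} {ψ : Mat p n → ℝ} (hψ : ψ ∈ tests p n)
    (hr₀ : 0 ≤ r₀) (hr₁ : 0 ≤ r₁)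
    (h₀ : ∀ θ ∈ nullSpace p n, ∀ S ∈ covClass p n B, ∫ X, ψ X ∂(law θ S) ≤ r₀)
    (h₁ : ∀ θ ∈ altSpace p n p ρ, ∀ S ∈ covClass p n B, ∫ X, (1 - ψ X) ∂(law θ S) ≤ r₁) :
    minimaxError p n B ρ ≤ r₀ + r₁ := by
  refine (ciInf_le ⟨0, ?_⟩ (⟨ψ, hψ⟩ : tests p n)).trans (add_le_add ?_ ?_)
  · rintro _ ⟨φ, rfl⟩
    exact add_nonneg
      (Real.iSup_nonneg fun x => integral_nonneg fun X => (φ.2.2 X).1)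
      (Real.iSup_nonneg fun x => integral_nonneg fun X => sub_nonneg.2 (φ.2.2 X).2)
  -- Nonnegativity of the bounds covers a supremum over an empty family, which is 0 by convention.
  · exact Real.iSup_le (fun x => h₀ _ x.1.2 _ x.2.2) hr₀
  · exact Real.iSup_le (fun x => h₁ _ x.1.2 _ x.2.2) hr₁

/-- The rejection region of the scan test with threshold `τ`. -/
def scanRegion (p n : ℕ) (τ : ℝ) : Set (Mat p n) :=
  ⋃ k ∈ Finset.range (Nat.log 2 n), {X | τ ≤ ‖columnSum (scanWeight n (2 ^ k)) X‖ ^ 2}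

lemma measurableSet_scanRegion (τ : ℝ) : MeasurableSet (scanRegion p n τ) :=
  Finset.measurableSet_biUnion _ fun _ _ => measurableSet_le (by fun_prop) (by fun_prop)

/-- The law of the noise of the scan statistic at scale `a`. -/
def scanNoise (S : Matrix (Fin p × Fin n) (Fin p × Fin n) ℝ) (a : ℕ) :
    Measure (EuclideanSpace ℝ (Fin p)) :=
  (law 0 S).map (columnSum (scanWeight n a))

instance (S : Matrix (Fin p × Fin n) (Fin p × Fin n) ℝ) (a : ℕ) : IsGaussian (scanNoise S a) := by
  unfold scanNoise
  infer_instance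

lemma law_real_preimage_columnSum (θ : Mat p n) (S : Matrix (Fin p × Fin n) (Fin p × Fin n) ℝ)
    (a : ℕ) {s : Set (EuclideanSpace ℝ (Fin p))} (hs : MeasurableSet s) :
    (law θ S).real (columnSum (scanWeight n a) ⁻¹' s) =
      (scanNoise S a).real {x | columnSum (scanWeight n a) θ + x ∈ s} := by
  have hm : MeasurableSet {x | columnSum (scanWeight n a) θ + x ∈ s} :=
    (measurable_const_add _) hs
  rw [law_eq_map, scanNoise, map_measureReal_apply (by fun_prop) (by measurability),
    map_measureReal_apply (by fun_prop) hm]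
  congr 1
  ext X
  simp

lemma covarianceBilin_scanNoise {S : Matrix (Fin p × Fin n) (Fin p × Fin n) ℝ}
    (hS : S ∈ covClass p n B) {a : ℕ} (ha0 : 0 < a) (ha : 2 * a ≤ n)
    (ξ : EuclideanSpace ℝ (Fin p)) :
    (1 - B) * ‖ξ‖ ^ 2 ≤ covarianceBilin (scanNoise S a) ξ ξ ∧
      covarianceBilin (scanNoise S a) ξ ξ ≤ (1 + B) * ‖ξ‖ ^ 2 := by
  have h := abs_dotProduct_mulVec_sub_le hS (sum_scanWeight_sq ha0 ha) ξ
  rw [scanNoise, covarianceBilin_map_columnSum hS.1]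
  rw [abs_le] at h
  constructor <;> linarith [h.1, h.2]

lemma law_real_scanRegion_le (hn : 2 ≤ n) (hB : 0 ≤ B) {κ s : ℝ} (hs : 0 ≤ s)
    (hκ : κ = 4 * (9 / 8 + s)) {θ : Mat p n} (hθ : θ ∈ nullSpace p n)
    {S : Matrix (Fin p × Fin n) (Fin p × Fin n) ℝ} (hS : S ∈ covClass p n B) :
    (law θ S).real (scanRegion p n ((1 + B) * (p + κ * scanRate p n))) ≤ 2 * exp (-s) := by
  obtain ⟨a, ha0, ha1, ha2, ha3⟩ := exists_chernoff_exponent p hn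
  have hL := one_le_loglog hn
  have hk (k : ℕ) (hk : k ∈ Finset.range (Nat.log 2 n)) :
      (law θ S).real {X | (1 + B) * (p + κ * scanRate p n) ≤
        ‖columnSum (scanWeight n (2 ^ k)) X‖ ^ 2} ≤ exp (-s) * exp (-loglog n) := by
    have hk' := two_mul_pow_le (by omega) (Finset.mem_range.1 hk)
    have h1 := law_real_preimage_columnSum θ S (2 ^ k)
      (s := {x | (1 + B) * (p + κ * scanRate p n) ≤ ‖x‖ ^ 2})
      (measurableSet_le (by fun_prop) (by fun_prop))
    rw [columnSum_scanWeight_of_mem_nullSpace hk' hθ] at h1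
    simp only [zero_add] at h1
    refine h1.trans_le ((measureReal_sq_norm_ge_le (scanNoise S (2 ^ k))
      (integral_id_map_columnSum _ _) (v := 1 + B) (by linarith)
      (fun t => (covarianceBilin_scanNoise hS (by positivity) hk' t).2) ha0 ha1).trans ?_)
    rw [← exp_add]
    refine exp_le_exp.2 ?_
    -- With `L = loglog n`, the exponent is at most `L / 8 - κ L / 4 = -(1 + s) L ≤ -s - L`; this
    -- dictates `κ`, and `-L` pays for the number of scales.
    have : κ * (loglog n / 4) ≤ κ * (a * scanRate p n) :=
      mul_le_mul_of_nonneg_left ha3 (by rw [hκ]; positivity)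
    rw [hκ] at this ⊢
    nlinarith [mul_nonneg hs (sub_nonneg.2 hL)]
  calc _ ≤ ∑ k ∈ Finset.range (Nat.log 2 n), (law θ S).real
        {X | (1 + B) * (p + κ * scanRate p n) ≤ ‖columnSum (scanWeight n (2 ^ k)) X‖ ^ 2} :=
        measureReal_biUnion_finset_le _ _
    _ ≤ ∑ k ∈ Finset.range (Nat.log 2 n), exp (-s) * exp (-loglog n) := Finset.sum_le_sum hk
    _ = Nat.log 2 n * (exp (-s) * exp (-loglog n)) := by simp
    _ ≤ 2 * exp (loglog n) * (exp (-s) * exp (-loglog n)) :=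
        mul_le_mul_of_nonneg_right (natLog_le_two_mul_exp_loglog hn) (by positivity)
    _ = 2 * exp (-s) := by
        rw [exp_neg (loglog n)]
        field_simp

lemma law_real_compl_scanRegion_le (hn : 2 ≤ n) (hB : 0 ≤ B) {κ s C : ℝ} (hs : 0 ≤ s)
    (hκ : κ = 4 * (9 / 8 + s)) (hC : 16 * κ ≤ C ^ 2) {θ : Mat p n}
    (hθ : θ ∈ altSpace p n p (C * rhoTemp p n B))
    {S : Matrix (Fin p × Fin n) (Fin p × Fin n) ℝ} (hS : S ∈ covClass p n B) :
    (law θ S).real (scanRegion p n ((1 + B) * (p + κ * scanRate p n)))ᶜ ≤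
      64 / C ^ 2 + exp (-s) := by
  obtain ⟨a, ha0, ha1, ha2, ha3⟩ := exists_chernoff_exponent p hn
  obtain ⟨t₀, ht₀, ht₀', hθ⟩ := hθ
  obtain ⟨k, hk, hk1, hk2, hk3⟩ := exists_scale ht₀ ht₀'
  have hk' := two_mul_pow_le (by omega) hk
  have hL := one_le_loglog hn
  have hM := one_le_scanRate (p := p) hn
  set M := scanRate p n with hMdef
  have hρ := sq_norm_columnSum_scanWeight (by positivity) hk' hk1 hk2 hk3 hθ
  set d := columnSum (scanWeight n (2 ^ k)) θ with hd
  rw [mul_pow, rhoTemp_sq hB hn, ← hMdef] at hρ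
  have hp : (0 : ℝ) ≤ p := by positivity
  have hBM : 0 ≤ (1 + B) * M := by positivity
  have hBp : 0 ≤ B * p := by positivity
  have hC' : 0 < C ^ 2 := by
    rw [hκ] at hC
    linarith
  have hdpos : C ^ 2 * (1 + B) ≤ 4 * ‖d‖ ^ 2 := by
    have : C ^ 2 * (1 + B) * 1 ≤ C ^ 2 * (1 + B) * M :=
      mul_le_mul_of_nonneg_left hM (by positivity)
    nlinarith [mul_nonneg hC'.le hBp]
  have hd0 : 0 < ‖d‖ ^ 2 := by
    have : 0 < C ^ 2 * (1 + B) := by positivity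
    linarith
  have hcov := covarianceBilin_scanNoise hS (a := 2 ^ k) (by positivity) hk'
  have hmean : (scanNoise S (2 ^ k))[id] = 0 := integral_id_map_columnSum _ _
  have h1 : (scanRegion p n ((1 + B) * (p + κ * M)))ᶜ ⊆
      columnSum (scanWeight n (2 ^ k)) ⁻¹' {x | ‖x‖ ^ 2 ≤ (1 + B) * (p + κ * M)} := by
    intro X hX
    by_contra hcon
    refine hX (Set.mem_biUnion (Finset.mem_coe.2 (Finset.mem_range.2 hk)) ?_)
    simp only [Set.mem_preimage, Set.mem_ofPred_eq, not_le] at hcon ⊢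
    exact hcon.le
  have h2 := law_real_preimage_columnSum θ S (2 ^ k)
    (s := {x | ‖x‖ ^ 2 ≤ (1 + B) * (p + κ * M)}) (measurableSet_le (by fun_prop) (by fun_prop))
  rw [← hd] at h2
  -- Outside both bad events, `‖d + x‖ ^ 2` exceeds `‖d‖ ^ 2 / 2 + (1 - B) * p - κ * M`. The gap to
  -- the threshold is `2 * B * p + κ * (2 + B) * M`, which `‖d‖ ^ 2 / 2` covers because `16 * κ ≤ C
  -- ^ 2`.
  have h3 : {x | d + x ∈ {x | ‖x‖ ^ 2 ≤ (1 + B) * (p + κ * M)}} ⊆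
      {x | ⟪d, x⟫ ≤ -(‖d‖ ^ 2 / 4)} ∪ {x | ‖x‖ ^ 2 ≤ (1 - B) * p - κ * M} := by
    intro x hx
    by_contra hcon
    simp only [Set.mem_ofPred_eq, Set.mem_union, not_or, not_le, norm_add_sq_real] at hx hcon
    have h4 : 16 * κ * (B * p + (1 + B) * M) ≤ C ^ 2 * (B * p + (1 + B) * M) :=
      mul_le_mul_of_nonneg_right hC (by positivity)
    have h5 : 0 ≤ (κ - 1) * (B * p) := mul_nonneg (by rw [hκ]; linarith) hBp
    have h6 : 0 ≤ κ * (B * M) := mul_nonneg (by rw [hκ]; positivity) (by positivity)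
    nlinarith [hcon.1, hcon.2]
  have h4 : (scanNoise S (2 ^ k)).real {x | ⟪d, x⟫ ≤ -(‖d‖ ^ 2 / 4)} ≤ 64 / C ^ 2 := by
    refine (measureReal_inner_le_neg_le _ hmean (by positivity) (fun t => (hcov t).2) d).trans ?_
    rw [div_le_div_iff₀ (by positivity) hC']
    nlinarith [mul_le_mul_of_nonneg_right hdpos hd0.le]
  have h5 : (scanNoise S (2 ^ k)).real {x | ‖x‖ ^ 2 ≤ (1 - B) * p - κ * M} ≤ exp (-s) := by
    have hκ0 : 0 < κ := by rw [hκ]; positivity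
    -- For `B > 1` the lower covariance bound is vacuous, but then the event requires a negative
    -- squared norm.
    rcases le_or_gt B 1 with hB1 | hB1
    · refine (measureReal_sq_norm_le_le _ hmean (by linarith) (by linarith)
        (fun t => (hcov t).1) ha0).trans (exp_le_exp.2 ?_)
      have : κ * (loglog n / 4) ≤ κ * (a * M) := mul_le_mul_of_nonneg_left ha3 hκ0.le
      rw [hκ] at this ⊢
      nlinarith [mul_nonneg hs (sub_nonneg.2 hL)]
    · have : {x : EuclideanSpace ℝ (Fin p) | ‖x‖ ^ 2 ≤ (1 - B) * p - κ * M} = ∅ := by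
        refine Set.eq_empty_of_forall_notMem fun x hx => ?_
        have hx : ‖x‖ ^ 2 ≤ (1 - B) * p - κ * M := hx
        nlinarith [sq_nonneg ‖x‖, mul_nonneg (sub_nonneg.2 hB1.le) hp,
          mul_pos hκ0 (show 0 < M by linarith)]
      rw [this, measureReal_empty]
      positivity
  calc _ ≤ _ := measureReal_mono h1
    _ = _ := h2
    _ ≤ _ := measureReal_mono h3
    _ ≤ _ := measureReal_union_le _ _
    _ ≤ _ := add_le_add h4 h5

theorem exists_minimaxError_le {ε : ℝ} (hε : 0 < ε) (hε1 : ε < 1) :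
    ∃ Cε : ℝ, 0 < Cε ∧ ∀ (p n : ℕ) (B : ℝ), 2 ≤ n → 0 ≤ B → ∀ C : ℝ, Cε < C →
      minimaxError p n B (C * rhoTemp p n B) ≤ ε := by
  set s := log (4 / ε) with hs
  have hs0 : 0 ≤ s := log_nonneg (by rw [le_div_iff₀ hε]; linarith)
  have hexp : exp (-s) = ε / 4 := by
    rw [hs, exp_neg, exp_log (by positivity), inv_div]
  set κ := 4 * (9 / 8 + s) with hκ
  have hκ0 : 0 < κ := by positivity
  -- The three terms give, in turn, the detection condition, `64 / C ^ 2 ≤ ε / 4`, and `1 ≤ C`,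
  -- whence `C ≤ C ^ 2`.
  refine ⟨16 * κ + 256 / ε + 1, by positivity, fun p n B hn hB C hC => ?_⟩
  have h256 : 0 < 256 / ε := by positivity
  have hCsq : C ≤ C ^ 2 := by nlinarith
  have hψ : (scanRegion p n ((1 + B) * (p + κ * scanRate p n))).indicator (fun _ => (1 : ℝ)) ∈
      tests p n := by
    refine ⟨measurable_const.indicator (measurableSet_scanRegion _), fun X => ?_⟩
    by_cases hX : X ∈ scanRegion p n ((1 + B) * (p + κ * scanRate p n)) <;> simp [hX]
  have hεhalf : ε = ε / 2 + ε / 2 := by ring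
  rw [hεhalf]
  refine minimaxError_le hψ (by linarith) (by linarith) (fun θ hθ S hS => ?_)
    (fun θ hθ S hS => ?_)
  · rw [integral_indicator_const _ (measurableSet_scanRegion _), smul_eq_mul, mul_one]
    refine (law_real_scanRegion_le hn hB hs0 hκ hθ hS).trans_eq ?_
    rw [hexp]
    ring
  · have : ∀ X : Mat p n, 1 - (scanRegion p n ((1 + B) * (p + κ * scanRate p n))).indicator
        (fun _ => (1 : ℝ)) X = (scanRegion p n ((1 + B) * (p + κ * scanRate p n)))ᶜ.indicator
        (fun _ => (1 : ℝ)) X := fun X => by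
      by_cases hX : X ∈ scanRegion p n ((1 + B) * (p + κ * scanRate p n)) <;> simp [hX]
    simp_rw [this]
    rw [integral_indicator_const _ (measurableSet_scanRegion _).compl, smul_eq_mul, mul_one]
    refine (law_real_compl_scanRegion_le hn hB hs0 hκ (by linarith) hθ hS).trans ?_
    have : 64 / C ^ 2 ≤ ε / 4 := by
      rw [div_le_div_iff₀ (by nlinarith) (by norm_num)]
      have : 256 / ε ≤ C ^ 2 := by linarith
      rw [div_le_iff₀ hε] at this
      linarith
    linarith

end UpperBound

/-! ### Reduction to mixtures and covariances with independent rows -/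

section LowerBoundTools

variable {p n : ℕ} {B : ℝ}

lemma integrable_of_mem_Icc {α : Type*} [MeasurableSpace α] {μ : Measure α} [IsFiniteMeasure μ]
    {f : α → ℝ} (hf : Measurable f) (hf' : ∀ x, 0 ≤ f x ∧ f x ≤ 1) : Integrable f μ :=
  (integrable_const (1 : ℝ)).mono' hf.aestronglyMeasurable (ae_of_all _ fun x => by
    rw [norm_eq_abs, abs_of_nonneg (hf' x).1]; exact (hf' x).2)

lemma integral_mem_Icc {α : Type*} [MeasurableSpace α] {μ : Measure α} [IsProbabilityMeasure μ]
    {f : α → ℝ} (hf : Measurable f) (hf' : ∀ x, 0 ≤ f x ∧ f x ≤ 1) :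
    0 ≤ ∫ x, f x ∂μ ∧ ∫ x, f x ∂μ ≤ 1 := by
  refine ⟨integral_nonneg fun x => (hf' x).1, ?_⟩
  refine (integral_mono (integrable_of_mem_Icc hf hf') (integrable_const 1)
    fun x => (hf' x).2).trans_eq (by simp)

lemma one_sub_mem_Icc {α : Type*} {f : α → ℝ} (hf' : ∀ x, 0 ≤ f x ∧ f x ≤ 1) (x : α) :
    0 ≤ 1 - f x ∧ 1 - f x ≤ 1 := by
  constructor <;> linarith [(hf' x).1, (hf' x).2]

/-- Replaces the two suprema by arbitrary uniform error bounds, so that priors can be integrated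
against them. The fact `0 ≤ b` serves where a prior leaves the alternative. -/
lemma le_minimaxError {ρ r : ℝ}
    (h : ∀ ψ ∈ tests p n, ∀ a b : ℝ, 0 ≤ b →
      (∀ θ ∈ nullSpace p n, ∀ S ∈ covClass p n B, ∫ X, ψ X ∂(law θ S) ≤ a) →
      (∀ θ ∈ altSpace p n p ρ, ∀ S ∈ covClass p n B, ∫ X, (1 - ψ X) ∂(law θ S) ≤ b) →
      r ≤ a + b) :
    r ≤ minimaxError p n B ρ := by
  have : Nonempty (tests p n) := ⟨⟨fun _ => 0, measurable_const, fun _ => by norm_num⟩⟩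
  refine le_ciInf fun ψ => h ψ.1 ψ.2 _ _ ?_ (fun θ hθ S hS => ?_) (fun θ hθ S hS => ?_)
  · exact Real.iSup_nonneg fun x => integral_nonneg fun X => sub_nonneg.2 (ψ.2.2 X).2
  · exact le_ciSup (f := fun x : nullSpace p n × covClass p n B => ∫ X, ψ.1 X ∂(law x.1.1 x.2.1))
      ⟨1, by rintro _ ⟨x, rfl⟩; exact (integral_mem_Icc ψ.2.1 ψ.2.2).2⟩ (⟨θ, hθ⟩, ⟨S, hS⟩)
  · exact le_ciSup (f := fun x : altSpace p n p ρ × covClass p n B =>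
      ∫ X, (1 - ψ.1 X) ∂(law x.1.1 x.2.1))
      ⟨1, by
        rintro _ ⟨x, rfl⟩
        exact (integral_mem_Icc (measurable_const.sub ψ.2.1) (one_sub_mem_Icc ψ.2.2)).2⟩
      (⟨θ, hθ⟩, ⟨S, hS⟩)

lemma law_add {S T : Matrix (Fin p × Fin n) (Fin p × Fin n) ℝ} (hS : S.PosSemidef)
    (hT : T.PosSemidef) : law 0 (S + T) = law 0 S ∗ law 0 T := by
  apply Measure.ext_of_charFun
  ext x
  rw [charFun_conv, law, law, law, charFun_multivariateGaussian hS,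
    charFun_multivariateGaussian hT, charFun_multivariateGaussian (hS.add hT), ← Complex.exp_add,
    Matrix.add_mulVec, dotProduct_add]
  congr 1
  push_cast
  simp
  ring

lemma integral_law (θ : Mat p n) (S : Matrix (Fin p × Fin n) (Fin p × Fin n) ℝ)
    {f : Mat p n → ℝ} (hf : Measurable f) :
    ∫ X, f X ∂(law θ S) = ∫ X, f (θ + X) ∂(law 0 S) := by
  rw [law_eq_map, integral_map (by fun_prop) hf.aestronglyMeasurable]

lemma measurable_integral_law (S : Matrix (Fin p × Fin n) (Fin p × Fin n) ℝ)
    {f : Mat p n → ℝ} (hf : Measurable f) : Measurable (fun θ => ∫ X, f X ∂(law θ S)) := by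
  simp_rw [integral_law _ S hf]
  have : Measurable (Function.uncurry fun θ X : Mat p n => f (θ + X)) :=
    hf.comp measurable_add
  exact this.stronglyMeasurable.integral_prod_right.measurable

/-- A summand `S` of the covariance can be read as a centred Gaussian prior on the mean: the source
of the confusion between signal and noise. -/
lemma integral_law_add {S T : Matrix (Fin p × Fin n) (Fin p × Fin n) ℝ} (hS : S.PosSemidef)
    (hT : T.PosSemidef) {f : Mat p n → ℝ} (hf : Measurable f) (hf' : ∀ x, 0 ≤ f x ∧ f x ≤ 1) :
    ∫ X, f X ∂(law 0 (S + T)) = ∫ θ, ∫ X, f X ∂(law θ T) ∂(law 0 S) := by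
  rw [law_add hS hT, integral_conv (integrable_of_mem_Icc hf hf')]
  simp_rw [← integral_law _ T hf]

lemma map_mulVec_stdGaussian {ι κ : Type*} [Fintype ι] [Fintype κ] [DecidableEq ι]
    (A : Matrix ι κ ℝ) :
    (stdGaussian (EuclideanSpace ℝ κ)).map
      (fun z => (WithLp.toLp 2 (A.mulVec z.ofLp) : EuclideanSpace ℝ ι)) =
        multivariateGaussian 0 (A * A.transpose) := by
  have hm : Measurable (fun z : EuclideanSpace ℝ κ =>
      (WithLp.toLp 2 (A.mulVec z.ofLp) : EuclideanSpace ℝ ι)) := by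
    unfold Matrix.mulVec dotProduct
    fun_prop
  have : IsProbabilityMeasure ((stdGaussian (EuclideanSpace ℝ κ)).map
      (fun z => (WithLp.toLp 2 (A.mulVec z.ofLp) : EuclideanSpace ℝ ι))) :=
    Measure.isProbabilityMeasure_map hm.aemeasurable
  apply Measure.ext_of_charFun
  ext x
  have hpsd : (A * A.transpose).PosSemidef := by
    simpa using Matrix.posSemidef_self_mul_conjTranspose A
  rw [charFun_apply, integral_map hm.aemeasurable (by fun_prop), charFun_multivariateGaussian hpsd]
  have h (z : EuclideanSpace ℝ κ) : ⟪(WithLp.toLp 2 (A.mulVec z.ofLp) : EuclideanSpace ℝ ι), x⟫ =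
      ⟪z, WithLp.toLp 2 (A.transpose.mulVec x.ofLp)⟫ := by
    simp only [EuclideanSpace.inner_eq_star_dotProduct, star_trivial]
    rw [Matrix.dotProduct_mulVec, ← Matrix.mulVec_transpose]
  simp_rw [h]
  rw [← charFun_apply, charFun_stdGaussian, ← Matrix.mulVec_mulVec, Matrix.dotProduct_mulVec,
    ← Matrix.mulVec_transpose, ← Complex.ofReal_pow, EuclideanSpace.real_norm_sq_eq]
  simp [dotProduct, pow_two, neg_div]

open scoped Kronecker in
/-- The covariance matrix of a noise with independent rows, each of covariance `K`. -/
def rowCov (p : ℕ) (K : Matrix (Fin n) (Fin n) ℝ) :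
    Matrix (Fin p × Fin n) (Fin p × Fin n) ℝ :=
  (1 : Matrix (Fin p) (Fin p) ℝ) ⊗ₖ K

lemma rowCov_add (K K' : Matrix (Fin n) (Fin n) ℝ) :
    rowCov p (K + K') = rowCov p K + rowCov p K' :=
  Matrix.kronecker_add _ _ _

lemma posSemidef_rowCov {K : Matrix (Fin n) (Fin n) ℝ} (hK : K.PosSemidef) :
    (rowCov p K).PosSemidef :=
  Matrix.PosSemidef.one.kronecker hK

lemma rowCov_mem_covClass {K : Matrix (Fin n) (Fin n) ℝ} (hK : K.PosSemidef)
    (hdiag : ∀ t, K t t = 1) (hB : ∀ t, ∑ s ∈ Finset.univ.erase t, |K s t| ≤ B) :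
    rowCov p K ∈ covClass p n B := by
  have hblock (s t) : block (rowCov p K) s t = K s t • (1 : Matrix (Fin p) (Fin p) ℝ) := by
    ext i j
    simp [block, rowCov, Matrix.kroneckerMap_apply, mul_comm]
  refine ⟨posSemidef_rowCov hK, fun t => by rw [hblock, hdiag, one_smul], fun t => ?_⟩
  refine (Finset.sum_le_sum fun s _ => ?_).trans (hB t)
  rw [hblock, opNorm, map_smul, map_one, norm_smul, norm_eq_abs]
  -- The identity has norm at most 1, not always equal to 1: it vanishes when `p = 0`.
  exact mul_le_of_le_one_right (abs_nonneg _) ContinuousLinearMap.norm_id_le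

end LowerBoundTools

/-! ### Random signals hidden in correlated noise: the term `B p` -/

section RandomSignal

variable {p n : ℕ} {B : ℝ}

/-- The rank-one matrix `δ u uᵀ`. -/
def rankOne (δ : ℝ) (u : Fin n → ℝ) : Matrix (Fin n) (Fin n) ℝ :=
  Matrix.of fun s t => δ * (u s * u t)

lemma posSemidef_rankOne {δ : ℝ} (hδ : 0 ≤ δ) (u : Fin n → ℝ) : (rankOne δ u).PosSemidef := by
  have := (Matrix.posSemidef_vecMulVec_self_star u).smul hδ
  convert this using 1
  ext s t
  simp [rankOne, Matrix.vecMulVec_apply]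

/-- The equicorrelated noise covariance with signs `u`. -/
def spiked (δ : ℝ) (u : Fin n → ℝ) : Matrix (Fin n) (Fin n) ℝ :=
  (1 - δ) • (1 : Matrix (Fin n) (Fin n) ℝ) + rankOne δ u

lemma posSemidef_spiked {δ : ℝ} (hδ : 0 ≤ δ) (hδ1 : δ ≤ 1) (u : Fin n → ℝ) :
    (spiked δ u).PosSemidef :=
  (Matrix.PosSemidef.one.smul (sub_nonneg.2 hδ1)).add (posSemidef_rankOne hδ u)

lemma rowCov_spiked_mem_covClass {δ : ℝ} (hδ : 0 ≤ δ) (hδ1 : δ ≤ 1) {u : Fin n → ℝ}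
    (hu : ∀ t, |u t| = 1) (hB : δ * n ≤ B) : rowCov p (spiked δ u) ∈ covClass p n B := by
  refine rowCov_mem_covClass (posSemidef_spiked hδ hδ1 u) (fun t => ?_) (fun t => ?_)
  · have : u t * u t = 1 := by rw [← abs_mul_abs_self, hu, one_mul]
    simp [spiked, rankOne, this]
  · calc _ = ∑ s ∈ Finset.univ.erase t, δ := by
          refine Finset.sum_congr rfl fun s hs => ?_
          simp [spiked, rankOne, Finset.ne_of_mem_erase hs, abs_mul, hu, abs_of_nonneg hδ]
      _ ≤ δ * n := by
          rw [Finset.sum_const, nsmul_eq_mul, mul_comm]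
          refine mul_le_mul_of_nonneg_left ?_ hδ
          exact_mod_cast (Finset.card_le_univ _).trans_eq (Fintype.card_fin n)
      _ ≤ B := hB

/-- The mean matrix with columns `√δ uₜ z`. -/
def signal (δ : ℝ) (u : Fin n → ℝ) (z : EuclideanSpace ℝ (Fin p)) : Mat p n :=
  WithLp.toLp 2 fun i => √δ * u i.2 * z i.1

lemma measurable_signal (δ : ℝ) (u : Fin n → ℝ) : Measurable (signal (p := p) δ u) := by
  unfold signal
  fun_prop

lemma map_signal {δ : ℝ} (hδ : 0 ≤ δ) (u : Fin n → ℝ) :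
    (stdGaussian (EuclideanSpace ℝ (Fin p))).map (signal δ u) = law 0 (rowCov p (rankOne δ u)) := by
  have h := map_mulVec_stdGaussian (Matrix.of fun (i : Fin p × Fin n) (j : Fin p) =>
    if i.1 = j then √δ * u i.2 else 0)
  have h1 : (fun z : EuclideanSpace ℝ (Fin p) => (WithLp.toLp 2 ((Matrix.of
      fun (i : Fin p × Fin n) (j : Fin p) => if i.1 = j then √δ * u i.2 else 0).mulVec z.ofLp) :
        Mat p n)) = signal δ u := by
    ext z i
    simp [signal, Matrix.mulVec, dotProduct]
  rw [h1] at h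
  rw [h, law]
  congr 1
  ext i j
  simp only [Matrix.mul_apply, Matrix.transpose_apply, Matrix.of_apply, rowCov, rankOne,
    Matrix.kroneckerMap_apply, Matrix.one_apply, ite_mul, zero_mul, Finset.sum_ite_eq,
    Finset.mem_univ, if_true, one_mul]
  split_ifs with h2 h3 h3
  · nth_rewrite 3 [← mul_self_sqrt hδ]
    ring
  · exact absurd h2.symm h3
  · exact absurd h3.symm h2
  · ring

lemma integral_law_rowCov_add {δ : ℝ} (hδ : 0 ≤ δ) (u : Fin n → ℝ)
    {K : Matrix (Fin n) (Fin n) ℝ} (hK : K.PosSemidef) {f : Mat p n → ℝ} (hf : Measurable f)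
    (hf' : ∀ x, 0 ≤ f x ∧ f x ≤ 1) :
    ∫ X, f X ∂(law 0 (rowCov p (rankOne δ u + K))) =
      ∫ z, ∫ X, f X ∂(law (signal δ u z) (rowCov p K)) ∂(stdGaussian _) := by
  rw [rowCov_add, integral_law_add (posSemidef_rowCov (posSemidef_rankOne hδ u))
    (posSemidef_rowCov hK) hf hf', ← map_signal hδ, integral_map
    (measurable_signal δ u).aemeasurable (measurable_integral_law _ hf).aestronglyMeasurable]

lemma signal_one_mem_nullSpace (δ : ℝ) (z : EuclideanSpace ℝ (Fin p)) :
    signal (n := n) δ (fun _ => 1) z ∈ nullSpace p n :=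
  ⟨√δ • z, fun j t => by simp [signal]⟩

/-- The signs of a change in the middle. -/
def midSign (n : ℕ) (t : Fin n) : ℝ := if (t : ℕ) < n / 2 then 1 else -1

lemma signal_midSign_mem_altSpace (hn : 2 ≤ n) {δ ρ : ℝ} (hδ : 0 ≤ δ)
    (hρ : ρ ^ 2 ≤ δ * n * p / 3) {z : EuclideanSpace ℝ (Fin p)} (hz : (p : ℝ) / 2 ≤ ‖z‖ ^ 2) :
    signal δ (midSign n) z ∈ altSpace p n p ρ := by
  refine ⟨n / 2, by omega, by omega, √δ • z, -(√δ • z), fun j t ht => ?_, fun j t ht => ?_, ?_, ?_⟩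
  · simp [signal, midSign, ht]
  · simp [signal, midSign, not_lt.2 ht]
  · exact (Set.ncard_le_card _).trans_eq (by simp)
  · have hn0 : (0 : ℝ) < n := by exact_mod_cast (by omega : 0 < n)
    -- Rounding is worst at `n = 3`. The factor `n / 6` obtained below, times `4 * δ * (p / 2)`, is
    -- the `δ * n * p / 3` of the hypothesis.
    have h1 : (n : ℝ) ≤ 3 * (n / 2 : ℕ) := by exact_mod_cast (by omega : n ≤ 3 * (n / 2))
    have h2 : 2 * ((n / 2 : ℕ) : ℝ) ≤ n := by exact_mod_cast (by omega : 2 * (n / 2) ≤ n)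
    have h3 : (n : ℝ) / 6 ≤ ((n / 2 : ℕ) : ℝ) * (n - (n / 2 : ℕ)) / n := by
      rw [le_div_iff₀ hn0]
      nlinarith
    have h4 : ‖√δ • z - -(√δ • z)‖ ^ 2 = 4 * δ * ‖z‖ ^ 2 := by
      rw [sub_neg_eq_add, ← two_smul ℝ, norm_smul, norm_smul, mul_pow, mul_pow]
      simp only [norm_eq_abs, sq_abs, sq_sqrt hδ]
      ring
    rw [h4]
    calc ρ ^ 2 ≤ n / 6 * (4 * δ * (p / 2)) := by linarith
      _ ≤ n / 6 * (4 * δ * ‖z‖ ^ 2) := by gcongr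
      _ ≤ _ := mul_le_mul_of_nonneg_right h3 (by positivity)

lemma stdGaussian_real_sq_norm_le :
    (stdGaussian (EuclideanSpace ℝ (Fin p))).real {z | ‖z‖ ^ 2 ≤ p / 2} ≤ exp (-(p / 32)) := by
  -- The value `a = 1 / 8` minimises `2 * a ^ 2 * p - a * p / 2`.
  have h := measureReal_sq_norm_le_le (stdGaussian (EuclideanSpace ℝ (Fin p)))
    integral_id_stdGaussian_eq_zero (v := 1) (a := 1 / 8) (y := p / 2) (by norm_num) le_rfl
    (fun t => by rw [covarianceBilin_stdGaussian_self, one_mul]) (by norm_num)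
  convert h using 3
  · ring_nf
  · ring

/-- The null and the alternative mixtures have the same law, up to signals of small norm. -/
theorem one_sub_exp_le_minimaxError (hn : 2 ≤ n) {δ ρ : ℝ} (hδ : 0 ≤ δ) (hδ1 : δ ≤ 1)
    (hB : δ * n ≤ B) (hρ : ρ ^ 2 ≤ δ * n * p / 3) :
    1 - exp (-(p / 32)) ≤ minimaxError p n B ρ := by
  refine le_minimaxError fun ψ hψ a b hb ha hb' => ?_
  have hψ1 : Measurable fun X => 1 - ψ X := measurable_const.sub hψ.1
  have h1 : |(1 : ℝ)| = 1 := abs_one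
  have hu (t : Fin n) : |midSign n t| = 1 := by
    unfold midSign
    split_ifs <;> simp
  have hnull : ∫ X, ψ X ∂(law 0 (rowCov p (rankOne δ (fun _ => 1) + spiked δ (midSign n)))) ≤ a := by
    rw [integral_law_rowCov_add hδ _ (posSemidef_spiked hδ hδ1 _) hψ.1 hψ.2]
    refine (integral_mono_of_nonneg (ae_of_all _ fun z => (integral_mem_Icc hψ.1 hψ.2).1)
      (integrable_const a) (ae_of_all _ fun z => ha _ (signal_one_mem_nullSpace δ z) _
        (rowCov_spiked_mem_covClass hδ hδ1 hu hB))).trans_eq (by simp)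
  have halt : ∫ X, (1 - ψ X) ∂(law 0 (rowCov p (rankOne δ (midSign n) + spiked δ (fun _ => 1)))) ≤
      b + exp (-(p / 32)) := by
    rw [integral_law_rowCov_add hδ _ (posSemidef_spiked hδ hδ1 _) hψ1 (one_sub_mem_Icc hψ.2)]
    have hs : MeasurableSet {z : EuclideanSpace ℝ (Fin p) | ‖z‖ ^ 2 ≤ p / 2} :=
      measurableSet_le (by fun_prop) (by fun_prop)
    have hi : Integrable (fun z => b +
        {z : EuclideanSpace ℝ (Fin p) | ‖z‖ ^ 2 ≤ p / 2}.indicator (fun _ => (1 : ℝ)) z)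
        (stdGaussian _) :=
      (integrable_const b).add ((integrable_const 1).indicator hs)
    refine (integral_mono_of_nonneg (ae_of_all _ fun z =>
      (integral_mem_Icc hψ1 (one_sub_mem_Icc hψ.2)).1) hi (ae_of_all _ fun z => ?_)).trans ?_
    · by_cases hz : ‖z‖ ^ 2 ≤ p / 2
      · have := (integral_mem_Icc hψ1 (one_sub_mem_Icc hψ.2)
          (μ := law (signal δ (midSign n) z) (rowCov p (spiked δ fun _ => 1)))).2
        simp only [Set.indicator, Set.mem_ofPred_eq, if_pos hz]
        linarith
      · simp only [Set.indicator, Set.mem_ofPred_eq, if_neg hz, add_zero]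
        exact hb' _ (signal_midSign_mem_altSpace hn hδ hρ (not_le.1 hz).le) _
          (rowCov_spiked_mem_covClass hδ hδ1 (fun _ => h1) hB)
    · rw [integral_add (integrable_const b) ((integrable_const 1).indicator hs),
        integral_indicator_const _ hs]
      simpa using stdGaussian_real_sq_norm_le
  -- Exchanging which spike is signal and which is noise leaves the total covariance unchanged, so
  -- both mixtures are the same law.
  have heq : rankOne δ (midSign n) + spiked δ (fun _ => 1) =
      rankOne δ (fun _ => 1) + spiked δ (midSign n) := by
    unfold spiked
    abel
  rw [heq, integral_sub (integrable_const 1) (integrable_of_mem_Icc hψ.1 hψ.2)] at halt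
  simp only [integral_const, probReal_univ, smul_eq_mul, mul_one] at halt
  linarith

end RandomSignal

/-! ### Second moment method -/

section SecondMoment

/-- The second moment method for a uniform mixture of shifted standard Gaussian measures. -/
lemma integral_mixture_sub_le {ι I : Type*} [Fintype ι] [Fintype I] [Nonempty I]
    (η : I → EuclideanSpace ℝ ι) {s : ℝ} (hs : 0 < s)
    (hη : ((Fintype.card I : ℝ)⁻¹) ^ 2 * ∑ i, ∑ k, exp ⟪η i, η k⟫ ≤ 1 + s ^ 2)
    {φ : EuclideanSpace ℝ ι → ℝ} (hφ : Measurable φ) (hφ' : ∀ z, 0 ≤ φ z ∧ φ z ≤ 1) :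
    (Fintype.card I : ℝ)⁻¹ * ∑ i, ∫ z, φ (η i + z) ∂(stdGaussian (EuclideanSpace ℝ ι)) -
      ∫ z, φ z ∂(stdGaussian (EuclideanSpace ℝ ι)) ≤ s := by
  set γ := stdGaussian (EuclideanSpace ℝ ι) with hγ
  set w := (Fintype.card I : ℝ)⁻¹ with hw
  have hcard : w * Fintype.card I = 1 := inv_mul_cancel₀ (by simp)
  set f : I → EuclideanSpace ℝ ι → ℝ := fun i z => exp (⟪η i, z⟫ - ‖η i‖ ^ 2 / 2) with hf
  have hfint (i) : Integrable (f i) γ := by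
    simp only [hf, exp_sub]
    exact (integrable_exp_inner _ integral_id_stdGaussian_eq_zero (η i)).div_const _
  have hf1 (i) : ∫ z, f i z ∂γ = 1 := by
    simp only [hf, exp_sub]
    rw [integral_div, integral_exp_inner _ integral_id_stdGaussian_eq_zero,
      covarianceBilin_stdGaussian_self, div_self (exp_pos _).ne']
  have hff (i k) (z) : f i z * f k z =
      exp ⟪η i + η k, z⟫ * exp (-(‖η i‖ ^ 2 / 2 + ‖η k‖ ^ 2 / 2)) := by
    simp only [hf]
    rw [← exp_add, ← exp_add, inner_add_left]
    ring_nf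
  have hffint (i k) : Integrable (fun z => f i z * f k z) γ := by
    simp_rw [hff]
    exact (integrable_exp_inner _ integral_id_stdGaussian_eq_zero _).mul_const _
  have hff1 (i k) : ∫ z, f i z * f k z ∂γ = exp ⟪η i, η k⟫ := by
    simp_rw [hff]
    rw [integral_mul_const, integral_exp_inner _ integral_id_stdGaussian_eq_zero,
      covarianceBilin_stdGaussian_self, ← exp_add, norm_add_sq_real]
    ring_nf
  set ℓ : EuclideanSpace ℝ ι → ℝ := fun z => w * ∑ i, f i z with hℓ
  have hℓint : Integrable ℓ γ := (integrable_finsetSum _ fun i _ => hfint i).const_mul w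
  have hℓ1 : ∫ z, ℓ z ∂γ = 1 := by
    simp only [hℓ]
    rw [integral_const_mul, integral_finsetSum _ fun i _ => hfint i]
    simp [hf1, hcard]
  have hℓsq (z) : ℓ z ^ 2 = w ^ 2 * ∑ i, ∑ k, f i z * f k z := by
    simp only [hℓ]
    rw [mul_pow, sq (∑ i, f i z), Finset.sum_mul_sum]
  have hℓsqint : Integrable (fun z => ℓ z ^ 2) γ := by
    simp_rw [hℓsq]
    exact (integrable_finsetSum _ fun i _ => integrable_finsetSum _ fun k _ =>
      hffint i k).const_mul _
  have hℓsq1 : ∫ z, ℓ z ^ 2 ∂γ ≤ 1 + s ^ 2 := by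
    simp_rw [hℓsq]
    rw [integral_const_mul, integral_finsetSum _ fun i _ => integrable_finsetSum _ fun k _ =>
      hffint i k]
    simp_rw [integral_finsetSum _ fun k _ => hffint _ k, hff1]
    exact hη
  have hshift : w * ∑ i, ∫ z, φ (η i + z) ∂γ = ∫ z, ℓ z * φ z ∂γ := by
    have hprod (i) : Integrable (fun z => f i z * φ z) γ :=
      (hfint i).mul_bdd hφ.aestronglyMeasurable (c := 1) (ae_of_all _ fun z => by
        rw [norm_eq_abs, abs_of_nonneg (hφ' z).1]; exact (hφ' z).2)
    have hcm (i) : ∫ z, φ (η i + z) ∂γ = ∫ z, f i z * φ z ∂γ :=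
      integral_comp_add_stdGaussian _ hφ
    simp_rw [hcm, hℓ, mul_assoc, Finset.sum_mul]
    rw [integral_const_mul, integral_finsetSum _ fun i _ => hprod i]
  have hℓφ : Integrable (fun z => ℓ z * φ z) γ :=
    hℓint.mul_bdd hφ.aestronglyMeasurable (c := 1) (ae_of_all _ fun z => by
      rw [norm_eq_abs, abs_of_nonneg (hφ' z).1]; exact (hφ' z).2)
  have hφint : Integrable φ γ := integrable_of_mem_Icc hφ hφ'
  rw [hshift, ← integral_sub hℓφ hφint]
  have hb1 : Integrable (fun z => ℓ z ^ 2 - 2 * ℓ z) γ := hℓsqint.sub (hℓint.const_mul 2)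
  have hb2 : Integrable (fun z => ℓ z ^ 2 - 2 * ℓ z + 1) γ := hb1.add (integrable_const 1)
  have hb3 : Integrable (fun z => (ℓ z ^ 2 - 2 * ℓ z + 1) / (2 * s)) γ := hb2.div_const _
  have hbound : Integrable (fun z => (ℓ z ^ 2 - 2 * ℓ z + 1) / (2 * s) + s / 2) γ :=
    hb3.add (integrable_const _)
  calc ∫ z, (ℓ z * φ z - φ z) ∂γ ≤ ∫ z, ((ℓ z ^ 2 - 2 * ℓ z + 1) / (2 * s) + s / 2) ∂γ := by
        refine integral_mono (hℓφ.sub hφint) hbound fun z => ?_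
        have h1 : ℓ z * φ z - φ z ≤ |ℓ z - 1| := by
          rw [← sub_one_mul]
          calc _ ≤ |ℓ z - 1| * φ z := mul_le_mul_of_nonneg_right (le_abs_self _) (hφ' z).1
            _ ≤ |ℓ z - 1| := mul_le_of_le_one_right (abs_nonneg _) (hφ' z).2
        -- This pointwise inequality replaces Cauchy–Schwarz: the variance of `ℓ` is at most `s ^
        -- 2`, so the integral is at most `s`.
        have h2 : |ℓ z - 1| ≤ (|ℓ z - 1| ^ 2) / (2 * s) + s / 2 := by
          rw [div_add_div _ _ (by positivity) (by norm_num), le_div_iff₀ (by positivity)]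
          nlinarith [sq_nonneg (|ℓ z - 1| - s)]
        rw [sq_abs] at h2
        refine h1.trans (h2.trans_eq ?_)
        ring
    _ = (∫ z, ℓ z ^ 2 ∂γ - 1) / (2 * s) + s / 2 := by
        rw [integral_add hb3 (integrable_const _), integral_div,
          integral_add hb1 (integrable_const 1), integral_sub hℓsqint (hℓint.const_mul 2), integral_const_mul, hℓ1]
        simp
        ring
    _ ≤ s ^ 2 / (2 * s) + s / 2 := by
        gcongr
        linarith
    _ = s := by
        field_simp
        ring

end SecondMoment

/-! ### Random signs and sums over scales -/

section Signs

/-- The sign `±1` of a Boolean. -/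
def sgn (b : Bool) : ℝ := if b then 1 else -1

lemma sgn_sq (b : Bool) : sgn b ^ 2 = 1 := by
  cases b <;> simp [sgn]

lemma sum_exp_mul_sgn (c : ℝ) (b : Bool) : ∑ b', exp (c * (sgn b * sgn b')) = 2 * cosh c := by
  rw [Fintype.sum_bool, cosh_eq]
  cases b <;> simp [sgn] <;> ring

lemma sum_exp_sum_sgn (p : ℕ) (c : ℝ) :
    ∑ v : Fin p → Bool, ∑ v' : Fin p → Bool, exp (c * ∑ j, sgn (v j) * sgn (v' j)) =
      (2 ^ p) ^ 2 * cosh c ^ p := by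
  have h (v : Fin p → Bool) : ∑ v' : Fin p → Bool, exp (c * ∑ j, sgn (v j) * sgn (v' j)) =
      (2 * cosh c) ^ p := by
    simp_rw [Finset.mul_sum, exp_sum]
    rw [← Fintype.piFinset_univ,
      Finset.sum_prod_piFinset Finset.univ fun j b' => exp (c * (sgn (v j) * sgn b'))]
    rw [Finset.prod_congr rfl fun j _ => sum_exp_mul_sgn c (v j)]
    simp
  simp_rw [h]
  simp
  ring

/-- The bounds `cosh x ≤ exp x` and `cosh x ≤ exp (x ^ 2 / 2)` serve small and large `p`
respectively. Bernoulli's inequality then makes the estimate linear in the correlation `q`, ready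
for a geometric sum. -/
lemma cosh_pow_le {p : ℕ} {β lam q : ℝ} (hβ : 0 ≤ β)
    (h : β * p ≤ lam ∨ β ^ 2 * p / 2 ≤ lam) (hq0 : 0 ≤ q) (hq1 : q ≤ 1) :
    cosh (β * q) ^ p ≤ 1 + q * (exp lam - 1) := by
  have h1 : cosh (β * q) ^ p ≤ exp (lam * q) := by
    rcases h with h | h
    · have : cosh (β * q) ≤ exp (β * q) := by
        rw [cosh_eq]
        have : exp (-(β * q)) ≤ exp (β * q) := exp_le_exp.2 (by nlinarith [mul_nonneg hβ hq0])
        linarith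
      refine (pow_le_pow_left₀ (cosh_pos _).le this p).trans ?_
      rw [← exp_nat_mul]
      refine exp_le_exp.2 ?_
      nlinarith [mul_le_mul_of_nonneg_right h hq0]
    · refine (pow_le_pow_left₀ (cosh_pos _).le (cosh_le_exp_half_sq _) p).trans ?_
      rw [← exp_nat_mul]
      refine exp_le_exp.2 ?_
      have h2 : q ^ 2 ≤ q := by nlinarith
      have h3 : 0 ≤ β ^ 2 * p / 2 := by positivity
      nlinarith [mul_le_mul_of_nonneg_left h2 h3, mul_le_mul_of_nonneg_right h hq0]
  refine h1.trans ?_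
  have := rpow_one_add_le_one_add_mul_self (s := exp lam - 1) (p := q)
    (by linarith [exp_pos lam]) hq0 hq1
  rwa [add_sub_cancel, ← exp_mul] at this

lemma sum_pow_le_four {r : ℝ} (hr0 : 0 ≤ r) (hr : r ≤ 3 / 4) (m : ℕ) :
    ∑ j ∈ Finset.range m, r ^ j ≤ 4 := by
  have h := geom_sum_mul_neg r m
  have h1 : 0 ≤ r ^ m := pow_nonneg hr0 m
  have h2 : 0 ≤ ∑ j ∈ Finset.range m, r ^ j := Finset.sum_nonneg fun j _ => pow_nonneg hr0 j
  nlinarith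

lemma sum_pow_dist_le {r : ℝ} (hr0 : 0 ≤ r) (hr : r ≤ 3 / 4) (K l : ℕ) :
    ∑ k ∈ Finset.range K, r ^ Nat.dist k l ≤ 8 := by
  -- The enlarged range can be split at `l` even when `l ≥ K`.
  calc _ ≤ ∑ k ∈ Finset.range (l + K), r ^ Nat.dist k l :=
        Finset.sum_le_sum_of_subset_of_nonneg (Finset.range_mono (by omega))
          fun _ _ _ => pow_nonneg hr0 _
    _ = ∑ k ∈ Finset.range l, r ^ (l - 1 - k + 1) + ∑ j ∈ Finset.range K, r ^ j := by
        rw [Finset.sum_range_add]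
        congr 1
        · refine Finset.sum_congr rfl fun k hk => ?_
          have := Finset.mem_range.1 hk
          rw [Nat.dist_eq_sub_of_le (by omega)]
          congr 1
          omega
        · refine Finset.sum_congr rfl fun k hk => ?_
          rw [Nat.dist_eq_sub_of_le_right (by omega)]
          congr 1
          omega
    _ = r * ∑ j ∈ Finset.range l, r ^ j + ∑ j ∈ Finset.range K, r ^ j := by
        rw [Finset.sum_range_reflect (fun j => r ^ (j + 1)), Finset.mul_sum]
        simp_rw [pow_succ']
    _ ≤ 4 + 4 := by
        have h1 := sum_pow_le_four hr0 hr l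
        have h2 := sum_pow_le_four hr0 hr K
        nlinarith
    _ = 8 := by norm_num

end Signs

/-! ### Block-constant noise and dyadic changes: the scan term -/

section BlockNoise

variable {p n : ℕ} {B : ℝ}

/-- The index of the block of length `m` that contains the time `t`. -/
def blockIdx (m : ℕ) (t : Fin n) : Fin n := ⟨t / m, (Nat.div_le_self _ _).trans_lt t.2⟩

/-- The matrix which is constant on time blocks of length `m`, with blocks given by the columns
of `z`. -/
def expand (m : ℕ) (z : Mat p n) : Mat p n := WithLp.toLp 2 fun i => z (i.1, blockIdx m i.2)

lemma expand_add (m : ℕ) (y z : Mat p n) : expand m (y + z) = expand m y + expand m z := by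
  ext i
  simp [expand]

lemma measurable_expand (m : ℕ) : Measurable (expand m : Mat p n → Mat p n) := by
  unfold expand
  fun_prop

/-- The covariance in time of a noise that is constant on blocks of length `m`. -/
def blockCov (n m : ℕ) : Matrix (Fin n) (Fin n) ℝ :=
  Matrix.of fun s t => if blockIdx m s = blockIdx m t then 1 else 0

lemma posSemidef_blockCov (m : ℕ) : (blockCov n m).PosSemidef := by
  have h := Matrix.posSemidef_self_mul_conjTranspose
    (Matrix.of fun s t : Fin n => if blockIdx m s = t then (1 : ℝ) else 0)
  convert h using 1
  ext s t
  simp [blockCov, Matrix.mul_apply, eq_comm]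

lemma rowCov_blockCov_mem_covClass {m : ℕ} (hm : 0 < m) (hB : (m : ℝ) ≤ 1 + B) :
    rowCov p (blockCov n m) ∈ covClass p n B := by
  refine rowCov_mem_covClass (posSemidef_blockCov m) (fun t => by simp [blockCov]) fun t => ?_
  have h1 : ∑ s, |blockCov n m s t| ≤ m := by
    have : ∀ s, |blockCov n m s t| = if blockIdx m s = blockIdx m t then 1 else 0 := fun s => by
      simp only [blockCov, Matrix.of_apply]
      split_ifs <;> simp
    simp_rw [this]
    rw [Finset.sum_boole]
    -- A block has at most `m` times, since residues modulo `m` separate them.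
    have hcard := Finset.card_le_card_of_injOn (s := {s : Fin n | blockIdx m s = blockIdx m t})
      (t := Finset.range m) (fun s => (s : ℕ) % m)
      (fun s _ => Finset.mem_coe.2 (Finset.mem_range.2 (Nat.mod_lt _ hm))) (fun s hs s' hs' h => by
        simp only [Finset.coe_filter, Finset.mem_univ, true_and, Set.mem_ofPred_eq] at hs hs'
        have h2 : (s : ℕ) / m = (s' : ℕ) / m := by
          have := hs.trans hs'.symm
          simpa [blockIdx] using this
        have h' : (s : ℕ) % m = (s' : ℕ) % m := h
        have h3 := Nat.div_add_mod (s : ℕ) m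
        rw [h2, h', Nat.div_add_mod] at h3
        exact Fin.ext h3.symm)
    rw [Finset.card_range] at hcard
    exact_mod_cast hcard
  rw [← Finset.sum_erase_add _ _ (Finset.mem_univ t)] at h1
  have h2 : |blockCov n m t t| = 1 := by simp [blockCov]
  linarith

lemma map_expand (m : ℕ) :
    (stdGaussian (Mat p n)).map (expand m) = law 0 (rowCov p (blockCov n m)) := by
  have h := map_mulVec_stdGaussian (Matrix.of fun (i k : Fin p × Fin n) =>
    if (i.1, blockIdx m i.2) = k then (1 : ℝ) else 0)
  have h1 : (fun z : Mat p n => (WithLp.toLp 2 ((Matrix.of fun (i k : Fin p × Fin n) =>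
      if (i.1, blockIdx m i.2) = k then (1 : ℝ) else 0).mulVec z.ofLp) : Mat p n)) =
        expand m := by
    ext z i
    simp [expand, Matrix.mulVec, dotProduct]
  rw [h1] at h
  rw [h, law]
  congr 1
  ext i k
  simp only [Matrix.mul_apply, Matrix.transpose_apply, Matrix.of_apply, rowCov, blockCov,
    Matrix.kroneckerMap_apply, Matrix.one_apply, ite_mul, zero_mul, Finset.sum_ite_eq,
    Finset.mem_univ, if_true, one_mul, Prod.mk.injEq]
  by_cases h2 : i.1 = k.1 <;> by_cases h3 : blockIdx m i.2 = blockIdx m k.2 <;>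
    simp [h2, h3, eq_comm]

lemma integral_law_expand (m : ℕ) (η : Mat p n) {f : Mat p n → ℝ} (hf : Measurable f) :
    ∫ X, f X ∂(law (expand m η) (rowCov p (blockCov n m))) =
      ∫ z, f (expand m (η + z)) ∂(stdGaussian (Mat p n)) := by
  have hf' : Measurable fun X => f (expand m η + X) := hf.comp (measurable_const_add _)
  rw [integral_law _ _ hf, ← map_expand, integral_map (measurable_expand m).aemeasurable
    hf'.aestronglyMeasurable]
  simp_rw [expand_add]

/-- A change of size `√β rᵏ v` after `2ᵏ` blocks. -/
def dyadicSignal (n : ℕ) (β r : ℝ) (k : ℕ) (v : Fin p → Bool) : Mat p n :=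
  WithLp.toLp 2 fun i => √β * r ^ k * sgn (v i.1) * firstTimes n (2 ^ k) i.2

/-- With `r = 1 / √2`, the indicators of the first `2 ^ k` blocks are normalised, and their
correlations depend only on the distance between scales. -/
lemma pow_mul_pow_mul_min {r : ℝ} (hr : r ^ 2 = 1 / 2) (k l : ℕ) :
    r ^ k * r ^ l * (min (2 ^ k) (2 ^ l) : ℕ) = r ^ Nat.dist k l := by
  have aux (k l : ℕ) (h : k ≤ l) :
      r ^ k * r ^ l * (min (2 ^ k) (2 ^ l) : ℕ) = r ^ Nat.dist k l := by
    obtain ⟨d, rfl⟩ := Nat.exists_eq_add_of_le h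
    rw [min_eq_left (Nat.pow_le_pow_right (by norm_num) h), Nat.dist_eq_sub_of_le h,
      Nat.add_sub_cancel_left, pow_add]
    push_cast
    have : r ^ k * (r ^ k * r ^ d) * 2 ^ k = (r ^ 2 * 2) ^ k * r ^ d := by
      rw [mul_pow, ← pow_mul, mul_comm 2 k, pow_mul]
      ring
    rw [this, hr]
    norm_num
  rcases le_total k l with h | h
  · exact aux k l h
  · rw [Nat.dist_comm, min_comm, mul_comm (r ^ k), aux l k h]

lemma inner_dyadicSignal {β r : ℝ} (hβ : 0 ≤ β) (hr : r ^ 2 = 1 / 2) {k l : ℕ}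
    (hk : 2 ^ k ≤ n) (v v' : Fin p → Bool) :
    ⟪dyadicSignal n β r k v, dyadicSignal n β r l v'⟫ =
      β * r ^ Nat.dist k l * ∑ j, sgn (v j) * sgn (v' j) := by
  have h (t : Fin n) : firstTimes n (2 ^ k) t * firstTimes n (2 ^ l) t =
      firstTimes n (min (2 ^ k) (2 ^ l)) t := by
    simp only [firstTimes, lt_min_iff]
    split_ifs <;> simp_all
  have h2 (j : Fin p) (t : Fin n) :
      √β * r ^ l * sgn (v' j) * firstTimes n (2 ^ l) t *
        (√β * r ^ k * sgn (v j) * firstTimes n (2 ^ k) t) =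
      (√β * √β) * (r ^ k * r ^ l) * (sgn (v j) * sgn (v' j)) *
        firstTimes n (min (2 ^ k) (2 ^ l)) t := by
    rw [← h]
    ring
  simp only [PiLp.inner_apply, dyadicSignal, RCLike.inner_apply, conj_trivial,
    Fintype.sum_prod_type, h2]
  simp_rw [← Finset.mul_sum, sum_firstTimes ((min_le_left _ _).trans hk), mul_self_sqrt hβ]
  rw [← Finset.sum_mul, ← Finset.mul_sum, ← pow_mul_pow_mul_min hr]
  ring

lemma expand_dyadicSignal_mem_altSpace {m k : ℕ} (hm : 0 < m) (hk : 2 * (m * 2 ^ k) ≤ n)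
    {β r ρ : ℝ} (hβ : 0 ≤ β) (hr : r ^ 2 = 1 / 2) (hρ : ρ ^ 2 ≤ m * (β * p) / 2)
    (v : Fin p → Bool) : expand m (dyadicSignal n β r k v) ∈ altSpace p n p ρ := by
  have hpos : 0 < m * 2 ^ k := by positivity
  have hlt (t : Fin n) : (t : ℕ) / m < 2 ^ k ↔ (t : ℕ) < m * 2 ^ k := by
    rw [Nat.div_lt_iff_lt_mul hm, mul_comm]
  refine ⟨m * 2 ^ k, hpos, by omega, WithLp.toLp 2 fun j => √β * r ^ k * sgn (v j), 0,
    fun j t ht => ?_, fun j t ht => ?_, (Set.ncard_le_card _).trans_eq (by simp), ?_⟩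
  · simp [expand, dyadicSignal, blockIdx, firstTimes, (hlt t).2 ht]
  · simp [expand, dyadicSignal, blockIdx, firstTimes, hlt t, not_lt.2 ht]
  · have hn : (0 : ℝ) < n := by exact_mod_cast (by omega : 0 < n)
    have h1 : 2 * ((m * 2 ^ k : ℕ) : ℝ) ≤ n := by exact_mod_cast hk
    -- The change occurs in the first half, so the weight is at least half of `m * 2 ^ k`; the
    -- factor `r ^ (2 * k)` cancels `2 ^ k` and gives the same energy at all scales.
    have h2 : ((m * 2 ^ k : ℕ) : ℝ) / 2 ≤
        ((m * 2 ^ k : ℕ) : ℝ) * (n - (m * 2 ^ k : ℕ)) / n := by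
      rw [le_div_iff₀ hn]
      have : (0 : ℝ) ≤ (m * 2 ^ k : ℕ) := by positivity
      nlinarith
    refine hρ.trans (le_trans (le_of_eq ?_) (mul_le_mul_of_nonneg_right h2 (sq_nonneg _)))
    rw [sub_zero, EuclideanSpace.real_norm_sq_eq]
    simp only [mul_pow, sgn_sq, sq_sqrt hβ, mul_one, Finset.sum_const, Finset.card_univ,
      Fintype.card_fin, nsmul_eq_mul]
    rw [← pow_mul, mul_comm k 2, pow_mul, hr]
    push_cast
    rw [div_pow, one_pow]
    field_simp

/-- The lower bound by dyadic changepoints under a noise that is constant on blocks. -/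
theorem one_sub_le_minimaxError {m K : ℕ} (hm : 0 < m) (hmB : (m : ℝ) ≤ 1 + B) (hK : 0 < K)
    (hmK : m * 2 ^ K ≤ n) {β lam s ρ : ℝ} (hβ : 0 ≤ β)
    (hlam : β * p ≤ lam ∨ β ^ 2 * p / 2 ≤ lam) (hρ : ρ ^ 2 ≤ m * (β * p) / 2) (hs : 0 < s)
    (hs' : 8 * (exp lam - 1) ≤ K * s ^ 2) : 1 - s ≤ minimaxError p n B ρ := by
  have hlam0 : 0 ≤ lam := by
    rcases hlam with h | h
    · exact le_trans (by positivity) h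
    · exact le_trans (by positivity) h
  obtain ⟨r, hr0, hr1, hr⟩ : ∃ r : ℝ, 0 ≤ r ∧ r ≤ 3 / 4 ∧ r ^ 2 = 1 / 2 := by
    refine ⟨√(1 / 2), sqrt_nonneg _, ?_, sq_sqrt (by norm_num)⟩
    rw [sqrt_le_left (by norm_num)]
    norm_num
  have hpow {k : ℕ} (hk : k < K) : 2 * (m * 2 ^ k) ≤ n := by
    refine le_trans ?_ hmK
    rw [mul_left_comm, ← pow_succ']
    exact Nat.mul_le_mul_left m (Nat.pow_le_pow_right (by norm_num) hk)
  have hpow' {k : ℕ} (hk : k < K) : 2 ^ k ≤ n := by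
    have h1 := hpow hk
    have h2 : 2 ^ k ≤ m * 2 ^ k := Nat.le_mul_of_pos_left _ hm
    omega
  have hKpos : (0 : ℝ) < K := by exact_mod_cast hK
  have : Nonempty (Fin K) := ⟨⟨0, hK⟩⟩
  set η : Fin K × (Fin p → Bool) → Mat p n := fun i => dyadicSignal n β r i.1 i.2 with hη
  have hchi : ((Fintype.card (Fin K × (Fin p → Bool)) : ℝ)⁻¹) ^ 2 *
      ∑ i, ∑ k, exp ⟪η i, η k⟫ ≤ 1 + s ^ 2 := by
    have h1 : ∑ i, ∑ k, exp ⟪η i, η k⟫ =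
        (2 ^ p) ^ 2 * ∑ k : Fin K, ∑ l : Fin K, cosh (β * r ^ Nat.dist k l) ^ p := by
      simp only [Fintype.sum_prod_type, hη]
      simp_rw [Finset.mul_sum, ← sum_exp_sum_sgn]
      refine Finset.sum_congr rfl fun k _ => ?_
      rw [Finset.sum_comm]
      refine Finset.sum_congr rfl fun l _ => Finset.sum_congr rfl fun v _ =>
        Finset.sum_congr rfl fun v' _ => ?_
      rw [inner_dyadicSignal hβ hr (hpow' k.2)]
    have h2 : ∑ k : Fin K, ∑ l : Fin K, cosh (β * r ^ Nat.dist k l) ^ p ≤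
        K ^ 2 + 8 * K * (exp lam - 1) := by
      calc _ ≤ ∑ l : Fin K, ∑ k : Fin K, (1 + r ^ Nat.dist k l * (exp lam - 1)) := by
            rw [Finset.sum_comm]
            exact Finset.sum_le_sum fun k _ => Finset.sum_le_sum fun l _ =>
              cosh_pow_le hβ hlam (pow_nonneg hr0 _) (pow_le_one₀ hr0 (by linarith))
        _ ≤ ∑ l : Fin K, (K + 8 * (exp lam - 1)) := by
            refine Finset.sum_le_sum fun l _ => ?_
            rw [Finset.sum_add_distrib, ← Finset.sum_mul,
              Fin.sum_univ_eq_sum_range (fun k => r ^ Nat.dist k l) K]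
            have := mul_le_mul_of_nonneg_right (sum_pow_dist_le hr0 hr1 K l)
              (sub_nonneg.2 (one_le_exp hlam0))
            simpa using this
        _ = K ^ 2 + 8 * K * (exp lam - 1) := by
            simp
            ring
    rw [h1]
    simp only [Fintype.card_prod, Fintype.card_fin, Fintype.card_fun, Fintype.card_bool]
    push_cast
    rw [inv_pow, inv_mul_le_iff₀ (by positivity), mul_pow, mul_comm ((K : ℝ) ^ 2), mul_assoc]
    refine mul_le_mul_of_nonneg_left (h2.trans ?_) (by positivity)
    nlinarith [mul_le_mul_of_nonneg_left hs' hKpos.le]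
  refine le_minimaxError fun ψ hψ a b hb ha hb' => ?_
  -- On block-constant data a test acts as a test on one independent column per block, where the
  -- second moment bound applies.
  set φ : Mat p n → ℝ := fun z => ψ (expand m z) with hφdef
  have hφ : Measurable φ := hψ.1.comp (measurable_expand m)
  have hφ' (z) : 0 ≤ φ z ∧ φ z ≤ 1 := hψ.2 _
  have hcov := rowCov_blockCov_mem_covClass (p := p) (n := n) hm hmB
  have hnull : ∫ z, φ z ∂(stdGaussian (Mat p n)) ≤ a := by
    have h0 : expand m (0 : Mat p n) = 0 := by
      ext i
      simp [expand]
    have h := ha (expand m 0) ⟨0, fun j t => by simp [h0]⟩ _ hcov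
    rw [integral_law_expand m 0 hψ.1] at h
    simpa using h
  have halt (i) : 1 - b ≤ ∫ z, φ (η i + z) ∂(stdGaussian (Mat p n)) := by
    have h := hb' _ (expand_dyadicSignal_mem_altSpace hm (hpow i.1.2) hβ hr hρ i.2) _ hcov
    have hψ1 : Measurable fun X => 1 - ψ X := measurable_const.sub hψ.1
    have hint : Integrable (fun z => ψ (expand m (η i + z))) (stdGaussian (Mat p n)) :=
      integrable_of_mem_Icc (hφ.comp (measurable_const_add _)) fun z => hφ' _
    rw [integral_law_expand m _ hψ1, integral_sub (integrable_const _) hint] at h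
    simp only [integral_const, probReal_univ, smul_eq_mul, mul_one] at h
    linarith
  have hmix := integral_mixture_sub_le η hs hchi hφ hφ'
  have hcard : (0 : ℝ) < Fintype.card (Fin K × (Fin p → Bool)) := by
    exact_mod_cast Fintype.card_pos
  have havg : 1 - b ≤ (Fintype.card (Fin K × (Fin p → Bool)) : ℝ)⁻¹ *
      ∑ i, ∫ z, φ (η i + z) ∂(stdGaussian (Mat p n)) := by
    rw [← div_eq_inv_mul, le_div_iff₀ hcard, mul_comm, ← nsmul_eq_mul, ← Finset.card_univ,
      ← Finset.sum_const]
    exact Finset.sum_le_sum fun i _ => halt i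
  linarith

end BlockNoise

/-! ### Choice of parameters and the lower bound -/

section LowerBound

variable {p n : ℕ} {B : ℝ}

/-- With `K = Nat.log 2 (n / m)`, a block length at most √n / 2 gives `8 * n ≤ 2 ^ (2 * K + 5)`, so
log (8n) is at most `7 * K`. -/
lemma exists_num_scales {m : ℕ} (hm : 0 < m) (hn : 2 ≤ n) (h : m = 1 ∨ 4 * m ^ 2 ≤ n) :
    ∃ K : ℕ, 0 < K ∧ m * 2 ^ K ≤ n ∧ exp (loglog n) ≤ 7 * K := by
  have h2 : 2 ≤ n / m := by
    rw [Nat.le_div_iff_mul_le hm]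
    rcases h with rfl | h
    · omega
    · nlinarith
  have h3 := Nat.pow_log_le_self 2 (show n / m ≠ 0 by omega)
  have h4 := Nat.lt_pow_succ_log_self (b := 2) (by norm_num) (n / m)
  have hK : 0 < Nat.log 2 (n / m) := Nat.log_pos (by norm_num) h2
  set K := Nat.log 2 (n / m) with hKdef
  refine ⟨K, hK, ?_, ?_⟩
  · calc m * 2 ^ K ≤ m * (n / m) := Nat.mul_le_mul_left m h3
      _ ≤ n := Nat.mul_div_le n m
  · have h5 : n < m * (2 * 2 ^ K) := by
      rw [Nat.div_lt_iff_lt_mul hm, pow_succ'] at h4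
      rwa [mul_comm m]
    have hKK : (2 ^ K) * (2 ^ K) = 2 ^ (2 * K) := by rw [← pow_add, two_mul]
    have h1K : 1 ≤ 2 ^ K := Nat.one_le_two_pow
    have h6 : n ≤ 4 * 2 ^ (2 * K) := by
      rw [← hKK]
      rcases h with rfl | h
      · nlinarith
      · by_contra! hcon
        have h7 : (m * (2 * 2 ^ K)) * (m * (2 * 2 ^ K)) ≤ n * n := by
          calc _ = (4 * m ^ 2) * (2 ^ K * 2 ^ K) := by ring
            _ ≤ n * n := Nat.mul_le_mul h (by omega)
        nlinarith
    have h7 : (8 * n : ℝ) ≤ 2 ^ (2 * K + 5) := by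
      have : 8 * n ≤ 2 ^ (2 * K + 5) := by rw [pow_add]; omega
      exact_mod_cast this
    have hn0 : (0 : ℝ) < n := by exact_mod_cast (by omega : 0 < n)
    rw [exp_loglog hn]
    have h8 := log_le_log (by positivity) h7
    rw [log_pow] at h8
    push_cast at h8
    have h9 : (1 : ℝ) ≤ K := by exact_mod_cast hK
    nlinarith [log_two_lt_d9]

lemma exp_mul_sub_one_le {κ x : ℝ} (hκ : 0 ≤ κ) (hκ1 : κ ≤ 1) :
    exp (κ * x) - 1 ≤ κ * exp x := by
  have h := rpow_one_add_le_one_add_mul_self (s := exp x - 1) (p := κ)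
    (by linarith [exp_pos x]) hκ hκ1
  rw [add_sub_cancel, ← exp_mul, mul_comm x] at h
  linarith

lemma exists_block_length {D : ℝ} (hD : 1 ≤ D) (hn : 2 ≤ n) (hB : 0 ≤ B)
    (hBD : B ≤ D * √n) : ∃ m : ℕ, 0 < m ∧ (m : ℝ) ≤ 1 + B ∧ 1 + B ≤ (1 + 4 * D) * m ∧
      (m = 1 ∨ 4 * m ^ 2 ≤ n) := by
  have hq0 : 0 ≤ B / (4 * D) := by positivity
  have hfl := Nat.floor_le hq0
  have hlt := Nat.lt_floor_add_one (B / (4 * D))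
  have hqB : B / (4 * D) ≤ B := div_le_self hB (by linarith)
  -- If the floor is 0 the block length is 1. Otherwise the floor is at least 1 and at most √n / 4,
  -- which absorbs the added 1 and yields `2 * m ≤ √n`.
  refine ⟨⌊B / (4 * D)⌋₊ + 1, by omega, by push_cast; linarith, ?_, ?_⟩
  · push_cast
    rw [div_lt_iff₀ (by positivity)] at hlt
    have : (0 : ℝ) ≤ ⌊B / (4 * D)⌋₊ := by positivity
    nlinarith
  · have hq : B / (4 * D) ≤ √n / 4 := by
      rw [div_le_div_iff₀ (by positivity) (by norm_num)]
      linarith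
    have h1 : (⌊B / (4 * D)⌋₊ : ℝ) ≤ √n / 4 := hfl.trans hq
    have hs := sq_sqrt (show (0 : ℝ) ≤ n by positivity)
    rcases Nat.eq_zero_or_pos ⌊B / (4 * D)⌋₊ with h0 | h0
    · left
      omega
    · right
      have h2 : (1 : ℝ) ≤ ⌊B / (4 * D)⌋₊ := by exact_mod_cast h0
      have h3 : 2 * ((⌊B / (4 * D)⌋₊ : ℝ) + 1) ≤ √n := by linarith
      have h4 : 4 * ((⌊B / (4 * D)⌋₊ : ℝ) + 1) ^ 2 ≤ n := by
        rw [← hs]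
        nlinarith
      exact_mod_cast h4

lemma scanRate_dichotomy (hp : 1 ≤ p) (hn : 2 ≤ n) {κ : ℝ} (hκ : 0 ≤ κ) (hκ1 : κ ≤ 1) :
    κ * scanRate p n / p * p ≤ κ * loglog n ∨
      (κ * scanRate p n / p) ^ 2 * p / 2 ≤ κ * loglog n := by
  have hL := one_le_loglog hn
  have hp0 : (0 : ℝ) < p := by exact_mod_cast hp
  rcases le_total (p : ℝ) (loglog n) with h | h
  · left
    rw [div_mul_cancel₀ _ hp0.ne', scanRate, max_eq_right]
    exact sqrt_le_iff.2 ⟨by linarith, by nlinarith⟩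
  · right
    have h1 : scanRate p n = √(p * loglog n) := by
      refine max_eq_left (le_sqrt_of_sq_le ?_)
      nlinarith
    have h2 : (κ * scanRate p n / p) ^ 2 * p / 2 = κ ^ 2 * loglog n / 2 := by
      rw [h1, div_pow, mul_pow, sq_sqrt (by positivity)]
      field_simp
    rw [h2]
    have h3 : κ ^ 2 * loglog n ≤ κ * loglog n :=
      mul_le_mul_of_nonneg_right (by nlinarith) (by linarith)
    have h4 : 0 ≤ κ ^ 2 * loglog n := by positivity
    linarith

lemma one_sub_le_minimaxError_of_scanRate {D ε ρ κ : ℝ} (hD : 1 ≤ D) (hε : 0 < ε) (hp : 1 ≤ p)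
    (hn : 2 ≤ n) (hB : 0 ≤ B) (hBD : B ≤ D * √n) (hκ : 0 ≤ κ) (hκ1 : κ ≤ 1)
    (hκε : 56 * κ ≤ ε ^ 2) (hρ : (1 + 4 * D) * ρ ^ 2 ≤ κ / 2 * ((1 + B) * scanRate p n)) :
    1 - ε ≤ minimaxError p n B ρ := by
  obtain ⟨m, hm, hmB, hBm, hmn⟩ := exists_block_length hD hn hB hBD
  obtain ⟨K, hK, hmK, hKL⟩ := exists_num_scales hm hn hmn
  have hM := one_le_scanRate (p := p) hn
  have hp0 : (0 : ℝ) < p := by exact_mod_cast hp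
  refine one_sub_le_minimaxError hm hmB hK hmK (β := κ * scanRate p n / p)
    (lam := κ * loglog n) (by positivity) (scanRate_dichotomy hp hn hκ hκ1) ?_ hε ?_
  · rw [div_mul_cancel₀ _ hp0.ne']
    have h1 : κ / 2 * ((1 + B) * scanRate p n) ≤ κ / 2 * ((1 + 4 * D) * m * scanRate p n) := by
      gcongr
    have h2 := hρ.trans h1
    refine le_of_mul_le_mul_left (h2.trans_eq ?_) (show 0 < 1 + 4 * D by linarith)
    ring
  -- The constant 56 is 8 · 7: `8 * (exp (κ * loglog n) - 1) ≤ 8 * κ * exp (loglog n) ≤ 56 * κ * K`.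
  · have h1 := exp_mul_sub_one_le (x := loglog n) hκ hκ1
    have h2 := mul_le_mul_of_nonneg_left hKL hκ
    have h3 : (0 : ℝ) ≤ K := by positivity
    nlinarith [mul_le_mul_of_nonneg_left hκε h3]

lemma one_sub_le_minimaxError_of_dense {D ε ρ c : ℝ} (hε : 0 < ε) (hp : 32 / ε ≤ p)
    (hn : 2 ≤ n) (hB : 0 ≤ B) (hBD : B ≤ D * √n) (hc : 6 * c ^ 2 ≤ 1) (hcD : 6 * c ^ 2 * D ≤ 1)
    (hρ : ρ ^ 2 ≤ 2 * c ^ 2 * (B * p)) : 1 - ε ≤ minimaxError p n B ρ := by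
  have hn0 : (0 : ℝ) < n := by exact_mod_cast (by omega : 0 < n)
  have hn1 : (1 : ℝ) ≤ n := by exact_mod_cast (by omega : 1 ≤ n)
  have hδn : 6 * c ^ 2 * B / n * n = 6 * c ^ 2 * B := div_mul_cancel₀ _ hn0.ne'
  have h1 : √(n : ℝ) ≤ n := sqrt_le_iff.2 ⟨hn0.le, by nlinarith⟩
  -- This `δ` makes `δ * n * p / 3` equal to `2 * c ^ 2 * (B * p)`; `hc` yields `δ * n ≤ B` and
  -- `hcD` yields `δ ≤ 1`.
  have h := one_sub_exp_le_minimaxError (p := p) (B := B) (ρ := ρ) (δ := 6 * c ^ 2 * B / n) hn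
    (by positivity) ?_ ?_ ?_
  · have hp0 : (0 : ℝ) < p := lt_of_lt_of_le (by positivity) hp
    have h2 : exp (-(p / 32)) ≤ ε := by
      rw [exp_neg, inv_le_comm₀ (exp_pos _) hε]
      have h3 := add_one_le_exp ((p : ℝ) / 32)
      have h4 : ε⁻¹ ≤ p / 32 := by
        rw [inv_eq_one_div, le_div_iff₀ (by norm_num)]
        exact (le_of_eq (by ring)).trans hp
      linarith
    linarith
  · rw [div_le_one hn0]
    calc 6 * c ^ 2 * B ≤ 6 * c ^ 2 * (D * √n) := by gcongr
      _ = 6 * c ^ 2 * D * √n := by ring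
      _ ≤ 1 * √n := by gcongr
      _ ≤ n := by linarith
  · rw [hδn]
    nlinarith
  · rw [hδn]
    linarith

theorem exists_one_sub_le_minimaxError {ε : ℝ} (hε : 0 < ε) :
    ∃ pε : ℕ, ∀ D : ℝ, 0 < D → ∃ cεD : ℝ, 0 < cεD ∧
      ∀ (p n : ℕ) (B : ℝ), 1 ≤ p → 2 ≤ n → 0 ≤ B → B ≤ D * √((n : ℝ) / (p : ℝ)) → pε ≤ p →
        ∀ c : ℝ, 0 < c → c < cεD → 1 - ε ≤ minimaxError p n B (c * rhoTemp p n B) := by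
  refine ⟨⌈32 / ε⌉₊, fun D hD => ?_⟩
  set D' := max D 1 with hD'
  have hD1 : 1 ≤ D' := le_max_right _ _
  set x := min 1 (ε ^ 2) / (2000 * D') with hx
  have hmin : 0 < min 1 (ε ^ 2) := lt_min one_pos (by positivity)
  have hx0 : 0 < x := by positivity
  have hxD : 2000 * D' * x = min 1 (ε ^ 2) := by
    rw [hx]
    field_simp
  refine ⟨min 1 x, lt_min one_pos hx0, fun p n B hp hn hB hBD hpε c hc hcx => ?_⟩
  have hc1 : c < 1 := hcx.trans_le (min_le_left _ _)
  have hcx' : c < x := hcx.trans_le (min_le_right _ _)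
  have hcD : 2000 * D' * c ^ 2 ≤ min 1 (ε ^ 2) := by
    rw [← hxD]
    gcongr
    nlinarith
  have hcD1 := hcD.trans (min_le_left _ _)
  have hcD2 := hcD.trans (min_le_right _ _)
  have hcc : c ^ 2 ≤ D' * c ^ 2 := le_mul_of_one_le_left (sq_nonneg c) hD1
  have hp1 : (1 : ℝ) ≤ p := by exact_mod_cast hp
  have hBD' : B ≤ D' * √n := by
    refine hBD.trans (mul_le_mul (le_max_left _ _) (sqrt_le_sqrt ?_) (sqrt_nonneg _) (by linarith))
    exact div_le_self (by positivity) hp1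
  have hρ : (c * rhoTemp p n B) ^ 2 = c ^ 2 * (B * p + (1 + B) * scanRate p n) := by
    rw [mul_pow, rhoTemp_sq hB hn]
  have hc2 := sq_nonneg c
  -- The dominant term is at least half of `rhoTemp ^ 2`, whence the factor 2 in the dense case and
  -- the factor 4 in `κ` in the other.
  rcases le_total ((1 + B) * scanRate p n) (B * p) with h | h
  · refine one_sub_le_minimaxError_of_dense (D := D') (c := c) hε (Nat.ceil_le.1 hpε) hn hB hBD'
      (by linarith) (by linarith) ?_
    rw [hρ]
    nlinarith [mul_le_mul_of_nonneg_left h hc2]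
  · refine one_sub_le_minimaxError_of_scanRate (κ := 4 * (1 + 4 * D') * c ^ 2) hD1 hε hp hn hB hBD'
      (by positivity) (by linarith) (by linarith) ?_
    rw [hρ]
    have h1 := mul_le_mul_of_nonneg_left h (show 0 ≤ (1 + 4 * D') * c ^ 2 by positivity)
    linarith

end LowerBound

end TemporalChangepoint

end

theorem mainTheorem11 :
    (∀ ε : ℝ, 0 < ε → ∃ pε : ℕ, ∀ D : ℝ, 0 < D → ∃ cεD : ℝ, 0 < cεD ∧
      ∀ (p n : ℕ) (B : ℝ), 1 ≤ p → 2 ≤ n → 0 ≤ B →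
        B ≤ D * Real.sqrt ((n : ℝ) / (p : ℝ)) → pε ≤ p →
        ∀ c : ℝ, 0 < c → c < cεD →
          1 - ε ≤ TemporalChangepoint.minimaxError p n B
            (c * TemporalChangepoint.rhoTemp p n B)) ∧
    (∀ ε : ℝ, 0 < ε → ε < 1 → ∃ Cε : ℝ, 0 < Cε ∧
      ∀ (p n : ℕ) (B : ℝ), 1 ≤ p → 2 ≤ n → 0 ≤ B →
        ∀ C : ℝ, Cε < C →
          TemporalChangepoint.minimaxError p n B
            (C * TemporalChangepoint.rhoTemp p n B) ≤ ε) := by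
  refine ⟨fun ε hε => TemporalChangepoint.exists_one_sub_le_minimaxError hε,
    fun ε hε hε1 => ?_⟩
  obtain ⟨Cε, hCε, h⟩ := TemporalChangepoint.exists_minimaxError_le hε hε1
  exact ⟨Cε, hCε, fun p n B _ hn hB C hC => h p n B hn hB C hC⟩
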